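/- Let $d \ge 2$ be an integer, and for $\xi \in \mathbb{R}^d$ put $\langle \xi \rangle := \sqrt{|\xi|^2+1}$. Let $$\Sigma := \{(\tau,\xi) \in \mathbb{R}\times\mathbb{R}^d : \tau = \langle \xi\rangle\}$$ be the upper sheet of the elliptic hyperboloid, equipped with the measure $\mu$ given by $\int_\Sigma f\,d\mu := \int_{\mathbb{R}^d} f(\langle\xi\rangle,\xi)\,\frac{d\xi}{\langle\xi\rangle}$. For $f : \Sigma \to \mathbb{C}$ continuous and compactly supported, let $$\mathcal{E} f(t,x) := \int_\Sigma e^{i(t,x)\cdot(\tau,\xi)} f(\tau,\xi)\,d\mu(\tau,\xi), \qquad (t,x)\in\mathbb{R}\times\mathbb{R}^d .$$ For $p,q\in[1,\infty]$, let $\mathcal{E}(p\to q)$ denote the statement that $\mathcal{E}$ extends to a bounded linear operator from $L^p(\Sigma,\mu)$ to $L^q(\mathbb{R}\times\mathbb{R}^d)$. Write $r'$ for the dual exponent of $r$: $r' = \frac{r}{r-1}$ for $1<r<\infty$, $\infty' = 1$, and $r' = \infty$ for $0 < r\le 1$. Proposition. Let $p,q \in [1,\infty]$. If $\mathcal{E}(p\to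 q)$ holds, then $$\Big(\tfrac{d}{d+2}\,q\Big)' \le p \le \min\Big\{\Big(\tfrac{d-1}{d+1}\,q\Big)',\, q\Big\},$$ and $(p,q)$ is equal neither to $\big(\frac{2d}{d-1},\frac{2d}{d-1}\big)$ nor to $\big(\frac{2(d+1)}{d},\frac{2(d+1)}{d}\big)$. -/

import Mathlib

open MeasureTheory
open scoped ENNReal

noncomputable section

namespace Hyperboloid

/-- `⟨ξ⟩ = √(|ξ|² + 1)`. -/
def bracket {d : ℕ} (ξ : EuclideanSpace ℝ (Fin d)) : ℝ := Real.sqrt (‖ξ‖ ^ 2 + 1)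

/-- The upper sheet `Σ = {(τ, ξ) ∈ ℝ × ℝᵈ : τ = ⟨ξ⟩}` of the elliptic hyperboloid. -/
def upperSheet (d : ℕ) : Set (ℝ × EuclideanSpace ℝ (Fin d)) := {w | w.1 = bracket w.2}

/-- The parametrization `ξ ↦ (⟨ξ⟩, ξ)` of `Σ`. -/
def param (d : ℕ) (ξ : EuclideanSpace ℝ (Fin d)) : upperSheet d := ⟨(bracket ξ, ξ), rfl⟩

/-- The Lorentz-invariant measure on `Σ`:
`∫_Σ f dμ = ∫_{ℝᵈ} f(⟨ξ⟩, ξ) dξ / ⟨ξ⟩`. -/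
def lorentzMeasure (d : ℕ) : Measure (upperSheet d) :=
  Measure.map (param d) (volume.withDensity fun ξ => ENNReal.ofReal (1 / bracket ξ))

/-- The extension operator
`ℰ f(t, x) = ∫_Σ e^{i (t, x) · (τ, ξ)} f(τ, ξ) dμ(τ, ξ)`. -/
def extension (d : ℕ) (f : upperSheet d → ℂ) (z : ℝ × EuclideanSpace ℝ (Fin d)) : ℂ :=
  ∫ w : upperSheet d,
    Complex.exp (Complex.I * ((z.1 * w.1.1 + inner ℝ z.2 w.1.2 : ℝ) : ℂ)) * f w
      ∂(lorentzMeasure d)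

theorem continuous_bracket {d : ℕ} :
    Continuous (bracket : EuclideanSpace ℝ (Fin d) → ℝ) := by
  unfold bracket
  fun_prop

theorem continuous_param (d : ℕ) : Continuous (param d) :=
  (continuous_bracket.prodMk continuous_id).subtype_mk _

theorem one_le_bracket {d : ℕ} (ξ : EuclideanSpace ℝ (Fin d)) : 1 ≤ bracket ξ := by
  unfold bracket
  rw [Real.one_le_sqrt]
  nlinarith [sq_nonneg ‖ξ‖]

/-- The measure on `Σ` is given by the integral formula that defines it. -/
theorem integral_lorentzMeasure (d : ℕ) (f : upperSheet d → ℂ) (hf : Continuous f) :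
    ∫ w, f w ∂(lorentzMeasure d) = ∫ ξ, f (param d ξ) / (bracket ξ : ℂ) := by
  unfold lorentzMeasure
  rw [integral_map (continuous_param d).aemeasurable hf.aestronglyMeasurable,
    integral_withDensity_eq_integral_toReal_smul]
  · refine integral_congr_ae (Filter.Eventually.of_forall fun ξ => ?_)
    have h := one_le_bracket ξ
    simp only
    rw [ENNReal.toReal_ofReal (by positivity), Complex.real_smul]
    push_cast
    ring
  · exact ((measurable_const.div continuous_bracket.measurable)).ennreal_ofReal
  · exact Filter.Eventually.of_forall fun _ => ENNReal.ofReal_lt_top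

instance instIsFiniteMeasureOnCompacts (d : ℕ) :
    IsFiniteMeasureOnCompacts (lorentzMeasure d) where
  lt_top_of_isCompact := by
    intro K hK
    have hle : (volume.withDensity fun ξ : EuclideanSpace ℝ (Fin d) =>
        ENNReal.ofReal (1 / bracket ξ)) ≤ volume := by
      conv_rhs => rw [← withDensity_one (μ := (volume : Measure (EuclideanSpace ℝ (Fin d))))]
      refine withDensity_mono (Filter.Eventually.of_forall fun ξ => ?_)
      simp only [Pi.one_apply, ENNReal.ofReal_le_one]
      exact (div_le_one (by linarith [one_le_bracket ξ])).2 (one_le_bracket ξ)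
    unfold lorentzMeasure
    rw [Measure.map_apply (continuous_param d).measurable hK.measurableSet]
    refine (hle _).trans_lt (lt_of_le_of_lt (measure_mono ?_)
      (hK.image (continuous_snd.comp continuous_subtype_val)).measure_lt_top)
    exact fun ξ hξ => ⟨param d ξ, hξ, rfl⟩

/-- `ℰ(p → q)`: the operator `ℰ`, initially defined on continuous compactly supported functions
on `Σ`, extends to a bounded linear operator from `Lᵖ(Σ, μ)` to `L^q(ℝ × ℝᵈ)`. -/
def ExtensionEstimate (d : ℕ) (p q : ℝ≥0∞) [Fact (1 ≤ p)] [Fact (1 ≤ q)] : Prop :=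
  ∃ T : Lp ℂ p (lorentzMeasure d) →L[ℂ]
      Lp ℂ q (volume : Measure (ℝ × EuclideanSpace ℝ (Fin d))),
    ∀ (f : upperSheet d → ℂ) (hf : Continuous f) (hfc : HasCompactSupport f),
      T ((hf.memLp_of_hasCompactSupport hfc).toLp f) =ᵐ[volume] extension d f

end Hyperboloid

end

/-! The operator is tested on families of smooth bumps, and powers of a scale `R` (or logarithms)
are compared. Density `g` with respect to `dξ` corresponds to `f = ⟨ξ⟩ g` on `Σ`.

Two examples use absence of oscillation. A bump at `|ξ| ≲ 1/R` has `|ℰf| ≳ R^{-d}` for `|t| ≲ R²`,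
`|x| ≲ R`, which gives the lower bound on `p`; a bump at `|ξ| ~ R` has `|ℰf| ≳ R^d` on a box of side
`1/R`, which gives `p ≤ ((d-1)q/(d+1))'`.

The other three need lower bounds on `ℰf` after the wave has spread, obtained without stationary
phase. The spatial `L²` norm is conserved; once most of it is known to lie in a set of volume `W`,
Hölder bounds the `L^q` norm below by a multiple of `W^{-(1/2-1/q)}`. Location is read off from
`Δ(e^{isφ}g) = -s²|∇φ|² e^{isφ}g + O(s)`: the Laplacian multiplies the Fourier transform by
`-4π²|w|²`, so Plancherel and Chebyshev confine it to `|w| ≲ s`, and to the shell `|2π|w| - s| ≲ 1`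
when `|∇φ| = 1`.

At unit frequency `W ~ t^d`, and integrating in `t` diverges for `q ≤ 2(d+1)/d`. At frequency `R`,
rescaling gives mass `1/R` and time `s = Rt`; up to `t ~ R` the wave does not distinguish the
hyperboloid from the cone, so `W ~ s^{d-1}`. The times `t ~ R` force `p ≤ q`, and the whole range
`1/R ≤ t ≤ R/4` produces `log R` at `p = q = 2d/(d-1)`. -/

noncomputable section

namespace Hyperboloid

open scoped SchwartzMap LineDeriv Laplacian FourierTransform ContDiff NNReal

/-! ### The Laplacian of an oscillating function -/

section Modulation

/-- The function `e^{i s φ} g`. -/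
def modulate {E : Type*} (φ : E → ℝ) (s : ℝ) (g : E → ℂ) (η : E) : ℂ :=
  Complex.exp (Complex.I * ((s * φ η : ℝ) : ℂ)) * g η

theorem norm_modulate {E : Type*} (φ : E → ℝ) (s : ℝ) (g : E → ℂ) (η : E) :
    ‖modulate φ s g η‖ = ‖g η‖ := by
  rw [modulate, norm_mul, mul_comm Complex.I, Complex.norm_exp_ofReal_mul_I, one_mul]

variable {E : Type*} [NormedAddCommGroup E] [InnerProductSpace ℝ E]

theorem hasLineDerivAt_modulate {φ : E → ℝ} {g : E → ℂ} {s φ' : ℝ} {g' : ℂ} {η v : E}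
    (hφ : HasLineDerivAt ℝ φ φ' η v) (hg : HasLineDerivAt ℝ g g' η v) :
    HasLineDerivAt ℝ (modulate φ s g)
      (modulate φ s (fun η => Complex.I * s * φ' * g η + g') η) η v := by
  have h1 := (((hφ.const_mul s).ofReal_comp).const_mul Complex.I).cexp.mul hg
  refine HasDerivAt.congr_deriv h1 ?_
  simp only [modulate, zero_smul, add_zero]
  push_cast
  ring

theorem contDiff_modulate {φ : E → ℝ} {g : E → ℂ} (hφ : ContDiff ℝ ∞ φ) (hg : ContDiff ℝ ∞ g)
    (s : ℝ) : ContDiff ℝ ∞ (modulate φ s g) := by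
  have : ContDiff ℝ ∞ fun η => ((s * φ η : ℝ) : ℂ) :=
    Complex.ofRealCLM.contDiff.comp (contDiff_const.mul hφ)
  exact ((contDiff_const.mul this).cexp).mul hg

theorem hasCompactSupport_modulate {E : Type*} [TopologicalSpace E] {g : E → ℂ}
    (hg : HasCompactSupport g) (φ : E → ℝ) (s : ℝ) :
    HasCompactSupport (modulate φ s g) := hg.mul_left

/-- The only quadratic term in `s` arises when both derivatives fall on the exponential; moving it
to the left leaves a transport term linear in `s` and a term free of `s`. -/
theorem lineDeriv_lineDeriv_modulate {φ : E → ℝ} {g : E → ℂ} (hφ : ContDiff ℝ ∞ φ)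
    (hg : ContDiff ℝ ∞ g) (s : ℝ) (f : 𝓢(E, ℂ)) (hf : ⇑f = modulate φ s g) (v η : E) :
    (∂_{v} (∂_{v} f)) η + s ^ 2 * (fderiv ℝ φ η v) ^ 2 * f η =
      modulate φ s (fun η => s * (Complex.I * (2 * (fderiv ℝ φ η v) * (fderiv ℝ g η v)
        + (fderiv ℝ (fun η => fderiv ℝ φ η v) η v) * g η))
        + fderiv ℝ (fun η => fderiv ℝ g η v) η v) η := by
  have key : ∀ {φ : E → ℝ} (_ : ContDiff ℝ ∞ φ) (η : E),
      HasLineDerivAt ℝ φ (fderiv ℝ φ η v) η v := fun hφ η =>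
    ((hφ.differentiable (by simp)) η).hasFDerivAt.hasLineDerivAt v
  have keyC : ∀ {φ : E → ℂ} (_ : ContDiff ℝ ∞ φ) (η : E),
      HasLineDerivAt ℝ φ (fderiv ℝ φ η v) η v := fun hφ η =>
    ((hφ.differentiable (by simp)) η).hasFDerivAt.hasLineDerivAt v
  have hφ1 : ContDiff ℝ ∞ (fun η => fderiv ℝ φ η v) :=
    (hφ.fderiv_right (m := ∞) (by simp)).clm_apply contDiff_const
  have hg1 : ContDiff ℝ ∞ (fun η => fderiv ℝ g η v) :=
    (hg.fderiv_right (m := ∞) (by simp)).clm_apply contDiff_const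
  have e1 : ⇑(∂_{v} f : 𝓢(E, ℂ)) = modulate φ s
      (fun η => Complex.I * s * ((fderiv ℝ φ η v : ℝ) : ℂ) * g η + fderiv ℝ g η v) := by
    ext x
    rw [SchwartzMap.lineDerivOp_apply, hf]
    exact (hasLineDerivAt_modulate (key hφ x) (keyC hg x)).lineDeriv
  have h2 : HasLineDerivAt ℝ
      (fun η => Complex.I * s * ((fderiv ℝ φ η v : ℝ) : ℂ) * g η + fderiv ℝ g η v)
      (Complex.I * s * ((fderiv ℝ (fun η => fderiv ℝ φ η v) η v : ℝ) : ℂ) * g η +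
        Complex.I * s * ((fderiv ℝ φ η v : ℝ) : ℂ) * fderiv ℝ g η v
        + fderiv ℝ (fun η => fderiv ℝ g η v) η v) η v := by
    have := ((((key hφ1 η).ofReal_comp).const_mul (Complex.I * s)).mul (keyC hg η)).add
      (keyC hg1 η)
    refine HasDerivAt.congr_deriv this ?_
    simp
  rw [SchwartzMap.lineDerivOp_apply, e1, (hasLineDerivAt_modulate (key hφ η) h2).lineDeriv, hf]
  simp only [modulate]
  linear_combination (Complex.exp (Complex.I * ((s * φ η : ℝ) : ℂ)) *
    (s ^ 2 * (fderiv ℝ φ η v) ^ 2 * g η)) * Complex.I_sq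

variable [FiniteDimensional ℝ E] [MeasurableSpace E] [BorelSpace E]

/-- If `f = e^{i s φ} g`, then `Δ f + s² |∇ φ|² f` is `O(s)` in `L²`. -/
theorem exists_eLpNorm_laplacian_modulate_le {φ : E → ℝ} {g : E → ℂ} (hφ : ContDiff ℝ ∞ φ)
    (hg : ContDiff ℝ ∞ g) (hgc : HasCompactSupport g) :
    ∃ C : ℝ≥0, ∀ s : ℝ, 1 ≤ s → ∀ f : 𝓢(E, ℂ), ⇑f = modulate φ s g →
      eLpNorm (fun η => (Δ f) η +
        s ^ 2 * ∑ i, ((fderiv ℝ φ η (stdOrthonormalBasis ℝ E i)) : ℂ) ^ 2 * f η) 2 volume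
        ≤ C * ENNReal.ofReal s := by
  set b := stdOrthonormalBasis ℝ E
  have hφ1 : ∀ v, ContDiff ℝ ∞ (fun η => fderiv ℝ φ η v) := fun v =>
    (hφ.fderiv_right (m := ∞) (by simp)).clm_apply contDiff_const
  have hg1 : ∀ v, ContDiff ℝ ∞ (fun η => fderiv ℝ g η v) := fun v =>
    (hg.fderiv_right (m := ∞) (by simp)).clm_apply contDiff_const
  set A : E → ℂ := fun η => ∑ i, (Complex.I * (2 * (fderiv ℝ φ η (b i)) * (fderiv ℝ g η (b i))
        + (fderiv ℝ (fun η => fderiv ℝ φ η (b i)) η (b i)) * g η)) with hA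
  set B : E → ℂ := fun η => ∑ i, fderiv ℝ (fun η => fderiv ℝ g η (b i)) η (b i) with hB
  have hAc : Continuous A := by
    refine continuous_finsetSum _ fun i _ => continuous_const.mul (.add (.mul (.mul
      continuous_const (Complex.continuous_ofReal.comp (hφ1 _).continuous)) (hg1 _).continuous)
      (.mul (Complex.continuous_ofReal.comp ?_) hg.continuous))
    exact (((hφ1 (b i)).fderiv_right (m := ∞) (by simp)).clm_apply contDiff_const).continuous
  have hBc : Continuous B := by
    refine continuous_finsetSum _ fun i _ => ?_
    exact (((hg1 (b i)).fderiv_right (m := ∞) (by simp)).clm_apply contDiff_const).continuous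
  -- Off `tsupport g` the germ of `g` vanishes, hence so do its derivatives.
  have hsub : ∀ η, η ∉ tsupport g → A η = 0 ∧ B η = 0 := by
    intro η hη
    have h0 : g =ᶠ[nhds η] 0 := notMem_tsupport_iff_eventuallyEq.1 hη
    have h1 : ∀ v, (fun η => fderiv ℝ g η v) =ᶠ[nhds η] 0 := fun v => by
      filter_upwards [h0.fderiv (𝕜 := ℝ)] with x hx
      simp [hx]
    constructor
    · refine Finset.sum_eq_zero fun i _ => ?_
      simp [h0.eq_of_nhds, (h1 (b i)).eq_of_nhds]
    · refine Finset.sum_eq_zero fun i _ => ?_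
      simp [(h1 (b i)).fderiv_eq]
  have hAs : HasCompactSupport A := HasCompactSupport.intro hgc fun η hη => (hsub η hη).1
  have hBs : HasCompactSupport B := HasCompactSupport.intro hgc fun η hη => (hsub η hη).2
  have hAm : MemLp (fun η => ‖A η‖ + ‖B η‖) 2 (volume : Measure E) :=
    ((hAc.memLp_of_hasCompactSupport hAs).norm).add ((hBc.memLp_of_hasCompactSupport hBs).norm)
  -- For `s ≥ 1`, `|sA + B| ≤ s(|A| + |B|)`; this constant depends on neither `s` nor the
  -- exponential.
  refine ⟨(eLpNorm (fun η => ‖A η‖ + ‖B η‖) 2 volume).toNNReal, fun s hs f hf => ?_⟩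
  rw [ENNReal.coe_toNNReal hAm.eLpNorm_ne_top]
  have hs0 : 0 ≤ s := by linarith
  calc _ ≤ eLpNorm (s • fun η => ‖A η‖ + ‖B η‖) 2 volume := by
        refine eLpNorm_mono fun η => ?_
        have : (Δ f) η + s ^ 2 * ∑ i, ((fderiv ℝ φ η (b i)) : ℂ) ^ 2 * f η =
            modulate φ s (fun η => s * A η + B η) η := by
          rw [SchwartzMap.laplacian_eq_sum b, sum_apply, Finset.mul_sum,
            ← Finset.sum_add_distrib]
          simp_rw [← mul_assoc]
          rw [Finset.sum_congr rfl fun i _ => lineDeriv_lineDeriv_modulate hφ hg s f hf (b i) η]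
          simp only [modulate, ← Finset.mul_sum, Finset.sum_add_distrib, hA, hB]
        rw [this, norm_modulate]
        simp only [Pi.smul_apply, smul_eq_mul]
        refine (norm_add_le _ _).trans ?_
        rw [norm_mul, Complex.norm_real, Real.norm_of_nonneg hs0, Real.norm_of_nonneg (by positivity)]
        nlinarith [norm_nonneg (B η)]
    _ = _ := by
        rw [eLpNorm_const_smul, mul_comm, Real.enorm_of_nonneg hs0]

theorem eLpNorm_fourier_two (f : 𝓢(E, ℂ)) :
    eLpNorm (𝓕 f : 𝓢(E, ℂ)) 2 volume = eLpNorm f 2 volume := by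
  have h := SchwartzMap.norm_fourier_toL2_eq f
  rw [SchwartzMap.norm_toLp, SchwartzMap.norm_toLp] at h
  have h1 : eLpNorm (𝓕 f : 𝓢(E, ℂ)) 2 volume ≠ ⊤ :=
    ((𝓕 f : 𝓢(E, ℂ)).memLp 2 volume).eLpNorm_ne_top
  have h2 : eLpNorm f 2 volume ≠ ⊤ := (f.memLp 2 volume).eLpNorm_ne_top
  rw [← ENNReal.ofReal_toReal h1, h, ENNReal.ofReal_toReal h2]

theorem fourier_laplacian_apply (f : 𝓢(E, ℂ)) (w : E) :
    (𝓕 (Δ f) : 𝓢(E, ℂ)) w = -((4 * Real.pi ^ 2 * ‖w‖ ^ 2 : ℝ) : ℂ) * (𝓕 f : 𝓢(E, ℂ)) w := by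
  set b := stdOrthonormalBasis ℝ E
  have hb : ∀ m : E, (inner ℝ · m : E → ℝ).HasTemperateGrowth := fun m =>
    ((innerSL ℝ).flip m).hasTemperateGrowth
  have hsum : 𝓕 (∑ i, ∂_{b i} (∂_{b i} f)) = ∑ i, 𝓕 (∂_{b i} (∂_{b i} f)) :=
    map_sum (SchwartzMap.fourierTransformCLM ℂ (V := E) (E := ℂ)) _ _
  rw [SchwartzMap.laplacian_eq_sum b, hsum, sum_apply, ← b.sum_sq_norm_inner_left w]
  simp only [SchwartzMap.fourier_lineDerivOp_eq, smul_apply, smul_eq_mul,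
    SchwartzMap.smulLeftCLM_apply_apply (hb _), Finset.mul_sum, Complex.ofReal_sum,
    ← Finset.sum_neg_distrib, Finset.sum_mul, Complex.real_smul, Real.norm_eq_abs, sq_abs]
  refine Finset.sum_congr rfl fun i _ => ?_
  push_cast
  linear_combination (4 * (Real.pi : ℂ) ^ 2 * (inner ℝ w (b i) : ℂ) ^ 2 * (𝓕 f : 𝓢(E, ℂ)) w) *
    Complex.I_sq

end Modulation

/-! ### From `L²` concentration to lower bounds in `L^q` -/

/-- A function with most of its `L²` norm on `S` has a large `L^q` norm, by Hölder's inequality. -/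
theorem half_le_eLpNorm_mul_measure_rpow {α : Type*} [MeasurableSpace α] {μ : Measure α}
    {F : α → ℂ} (hF : AEStronglyMeasurable F μ) {S : Set α} (hS : MeasurableSet S) {N : ℝ≥0∞}
    (hN' : N ≠ ⊤) (hN : N ≤ eLpNorm F 2 μ) (htail : eLpNorm F 2 (μ.restrict Sᶜ) ≤ N / 2)
    {q : ℝ≥0∞} (hq : 2 ≤ q) :
    N / 2 ≤ eLpNorm F q μ * μ S ^ (1 / 2 - 1 / q.toReal) := by
  have h1 : eLpNorm F 2 μ ≤ eLpNorm F 2 (μ.restrict S) + eLpNorm F 2 (μ.restrict Sᶜ) := by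
    rw [← eLpNorm_indicator_eq_eLpNorm_restrict hS,
      ← eLpNorm_indicator_eq_eLpNorm_restrict hS.compl]
    refine le_trans (le_of_eq ?_) (eLpNorm_add_le (hF.indicator hS) (hF.indicator hS.compl)
      (by norm_num))
    rw [Set.indicator_self_add_compl]
  have h2 : N / 2 ≤ eLpNorm F 2 (μ.restrict S) := by
    have h3 : N / 2 + N / 2 ≤ eLpNorm F 2 (μ.restrict S) + N / 2 := by
      rw [ENNReal.add_halves]
      exact hN.trans (h1.trans (by gcongr))
    exact (ENNReal.add_le_add_iff_right (ENNReal.div_ne_top hN' (by norm_num))).1 h3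
  refine h2.trans ((eLpNorm_le_eLpNorm_mul_rpow_measure_univ hq hF.restrict).trans ?_)
  rw [Measure.restrict_apply_univ]
  simp only [ENNReal.toReal_ofNat]
  gcongr
  exact Measure.restrict_le_self

theorem eLpNorm_restrict_le_of_le_norm {α : Type*} [MeasurableSpace α] {μ : Measure α}
    {F G : α → ℂ} {S : Set α} (hS : MeasurableSet S) {L : ℝ} (hL : 0 < L)
    (h : ∀ x ∈ S, L * ‖F x‖ ≤ ‖G x‖) (p : ℝ≥0∞) :
    ENNReal.ofReal L * eLpNorm F p (μ.restrict S) ≤ eLpNorm G p μ := by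
  calc ENNReal.ofReal L * eLpNorm F p (μ.restrict S) = eLpNorm (L • F) p (μ.restrict S) := by
        rw [eLpNorm_const_smul, Real.enorm_of_nonneg hL.le]
    _ ≤ eLpNorm G p (μ.restrict S) := by
        refine eLpNorm_mono_ae ((ae_restrict_iff' hS).2 (Filter.Eventually.of_forall fun x hx => ?_))
        rw [Pi.smul_apply, norm_smul, Real.norm_of_nonneg hL.le]
        exact h x hx
    _ ≤ _ := eLpNorm_mono_measure _ Measure.restrict_le_self

section Concentration

variable {E : Type*} [NormedAddCommGroup E] [InnerProductSpace ℝ E] [FiniteDimensional ℝ E]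
  [MeasurableSpace E] [BorelSpace E]

/-- Where `|P| ≥ L`, `|𝓕 f₀| ≤ |𝓕 u| / L`, so by Plancherel this region carries at most a quarter of
`‖f‖₂` from `f₀` and another quarter from `f - f₀`; Hölder does the rest. The companion `f₀` allows
a phase whose equation is only approximate to be replaced by one for which `u` is small. -/
theorem half_eLpNorm_le_of_multiplier {f f₀ u : 𝓢(E, ℂ)} {P : E → ℝ} (hP : Continuous P)
    (hu : ∀ w, (𝓕 u : 𝓢(E, ℂ)) w = P w * (𝓕 f₀ : 𝓢(E, ℂ)) w) {L : ℝ} (hL : 0 < L)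
    (hsub : eLpNorm (f - f₀ : 𝓢(E, ℂ)) 2 volume ≤ eLpNorm f 2 volume / 4)
    (hu2 : eLpNorm u 2 volume ≤ ENNReal.ofReal L * (eLpNorm f 2 volume / 4))
    {q : ℝ≥0∞} (hq : 2 ≤ q) :
    eLpNorm f 2 volume / 2 ≤
      eLpNorm (𝓕 f : 𝓢(E, ℂ)) q volume * volume {w | |P w| < L} ^ (1 / 2 - 1 / q.toReal) := by
  have hS : MeasurableSet {w | |P w| < L} := (isOpen_lt hP.abs continuous_const).measurableSet
  have hfT : eLpNorm f 2 volume ≠ ⊤ := (f.memLp 2 volume).eLpNorm_ne_top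
  refine half_le_eLpNorm_mul_measure_rpow (𝓕 f : 𝓢(E, ℂ)).continuous.aestronglyMeasurable hS hfT
    (eLpNorm_fourier_two f).ge ?_ hq
  have hdec : (⇑(𝓕 f : 𝓢(E, ℂ))) = ⇑(𝓕 (f - f₀) : 𝓢(E, ℂ)) + ⇑(𝓕 f₀ : 𝓢(E, ℂ)) := by
    have : (𝓕 f : 𝓢(E, ℂ)) = 𝓕 (f - f₀) + 𝓕 f₀ := by
      rw [← FourierTransform.fourier_add, sub_add_cancel]
    ext x
    rw [this]; rfl
  have h1 : eLpNorm (𝓕 (f - f₀) : 𝓢(E, ℂ)) 2 (volume.restrict {w | |P w| < L}ᶜ) ≤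
      eLpNorm f 2 volume / 4 :=
    (eLpNorm_mono_measure _ Measure.restrict_le_self).trans
      ((eLpNorm_fourier_two (f - f₀)).le.trans hsub)
  have h2 : eLpNorm (𝓕 f₀ : 𝓢(E, ℂ)) 2 (volume.restrict {w | |P w| < L}ᶜ) ≤
      eLpNorm f 2 volume / 4 := by
    have h3 := (eLpNorm_restrict_le_of_le_norm (F := (𝓕 f₀ : 𝓢(E, ℂ))) (G := (𝓕 u : 𝓢(E, ℂ)))
      (μ := volume) hS.compl hL (fun x hx => by
        rw [hu, norm_mul, Complex.norm_real]
        have : L ≤ |P x| := not_lt.1 hx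
        exact mul_le_mul_of_nonneg_right this (norm_nonneg _)) 2).trans
      ((eLpNorm_fourier_two u).le.trans hu2)
    exact (ENNReal.mul_le_mul_iff_right (by simpa using hL) ENNReal.ofReal_ne_top).1 h3
  rw [hdec]
  refine (eLpNorm_add_le (𝓕 (f - f₀) : 𝓢(E, ℂ)).continuous.aestronglyMeasurable
    (𝓕 f₀ : 𝓢(E, ℂ)).continuous.aestronglyMeasurable (by norm_num)).trans
    ((add_le_add h1 h2).trans (le_of_eq ?_))
  rw [← ENNReal.toReal_eq_toReal_iff' (by finiteness) (by finiteness),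
    ENNReal.toReal_add (by finiteness) (by finiteness)]
  simp only [ENNReal.toReal_div, ENNReal.toReal_ofNat]
  ring

theorem half_sub_one_div_toReal_nonneg {q : ℝ≥0∞} (hq : 2 ≤ q) : 0 ≤ 1 / 2 - 1 / q.toReal := by
  rcases eq_or_ne q ⊤ with rfl | hqT
  · simp
  · have : (2 : ℝ) ≤ q.toReal := by
      simpa using ENNReal.toReal_mono hqT hq
    rw [sub_nonneg]
    gcongr

theorem exists_pos_ofReal_le {N : ℝ≥0∞} (hN : N ≠ 0) : ∃ c : ℝ, 0 < c ∧
    ENNReal.ofReal c ≤ N := by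
  obtain ⟨r, hr, hr'⟩ := ENNReal.lt_iff_exists_nnreal_btwn.1 (pos_iff_ne_zero.2 hN)
  exact ⟨r, by exact_mod_cast hr, by rw [ENNReal.ofReal_coe_nnreal]; exact hr'.le⟩

theorem exists_mul_le {C N : ℝ≥0∞} (hC : C ≠ ⊤) (hN : N ≠ 0) : ∃ K : ℝ, 1 ≤ K ∧
    C ≤ ENNReal.ofReal K * N := by
  obtain ⟨c, hc, hcN⟩ := exists_pos_ofReal_le hN
  refine ⟨max 1 (C.toReal / c), le_max_left _ _, ?_⟩
  calc C = ENNReal.ofReal (C.toReal / c * c) := by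
        rw [div_mul_cancel₀ _ hc.ne', ENNReal.ofReal_toReal hC]
    _ = ENNReal.ofReal (C.toReal / c) * ENNReal.ofReal c := ENNReal.ofReal_mul (by positivity)
    _ ≤ _ := by gcongr; exact le_max_right _ _

theorem eLpNorm_two_ne_zero {g : E → ℂ} (hg : Continuous g) (h0 : g ≠ 0) :
    eLpNorm g 2 volume ≠ 0 := by
  rw [Ne, eLpNorm_eq_zero_iff hg.aestronglyMeasurable (by norm_num)]
  intro h
  exact h0 ((Continuous.ae_eq_iff_eq volume hg continuous_const).1 h)

theorem eLpNorm_modulate (φ : E → ℝ) (s : ℝ) (g : E → ℂ) (p : ℝ≥0∞) :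
    eLpNorm (modulate φ s g) p volume = eLpNorm g p volume :=
  eLpNorm_congr_norm_ae (Filter.Eventually.of_forall fun η => norm_modulate φ s g η)

/-- Dispersive bound from below: at time `s` the wave `𝓕 (e^{i s φ} g)` lives at scale `s`. -/
theorem exists_le_eLpNorm_fourier_modulate {φ : E → ℝ} {g : E → ℂ} (hφ : ContDiff ℝ ∞ φ)
    (hg : ContDiff ℝ ∞ g) (hgc : HasCompactSupport g) (h0 : g ≠ 0) :
    ∃ N V : ℝ, 0 < N ∧ 0 < V ∧ ∀ s : ℝ, 1 ≤ s → ∀ q : ℝ≥0∞, 2 ≤ q →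
      ENNReal.ofReal N ≤ eLpNorm (𝓕 (modulate φ s g)) q volume *
        ENNReal.ofReal (V * s ^ Module.finrank ℝ E) ^ (1 / 2 - 1 / q.toReal) := by
  obtain ⟨C, hC⟩ := exists_eLpNorm_laplacian_modulate_le hφ hg hgc
  set M := eLpNorm g 2 volume with hM
  have hM0 : M ≠ 0 := eLpNorm_two_ne_zero hg.continuous h0
  set b := stdOrthonormalBasis ℝ E
  set G : E → ℂ := fun η => ∑ i, ((fderiv ℝ φ η (b i)) : ℂ) ^ 2 * g η with hG
  have hGm : MemLp G 2 (volume : Measure E) := by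
    refine Continuous.memLp_of_hasCompactSupport ?_ ?_
    · refine continuous_finsetSum _ fun i _ => .mul (.pow (Complex.continuous_ofReal.comp ?_) 2)
        hg.continuous
      exact ((hφ.fderiv_right (m := ∞) (by simp)).clm_apply contDiff_const).continuous
    · refine HasCompactSupport.intro hgc fun η hη => Finset.sum_eq_zero fun i _ => ?_
      rw [image_eq_zero_of_notMem_tsupport hη, mul_zero]
  -- `K` is the Chebyshev level: beyond `4π²|w|² = K s²` at most a quarter of the `L²` norm remains.
  obtain ⟨K, hK1, hK⟩ := exists_mul_le (C := C + eLpNorm G 2 volume) (N := M / 4)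
    (by have := hGm.eLpNorm_ne_top; finiteness) (ENNReal.div_ne_zero.2 ⟨hM0, by norm_num⟩)
  obtain ⟨N, hN, hNM⟩ := exists_pos_ofReal_le (N := M / 2)
    (ENNReal.div_ne_zero.2 ⟨hM0, by norm_num⟩)
  set v := volume (Metric.ball (0 : E) 1)
  have hv0 : v ≠ 0 := (Metric.measure_ball_pos _ _ one_pos).ne'
  have hvT : v ≠ ⊤ := measure_ball_lt_top.ne
  refine ⟨N, K ^ Module.finrank ℝ E * v.toReal, hN,
    mul_pos (by positivity) (ENNReal.toReal_pos hv0 hvT), fun s hs q hq => ?_⟩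
  have hs0 : 0 < s := by linarith
  set f : 𝓢(E, ℂ) := (hasCompactSupport_modulate hgc φ s).toSchwartzMap (contDiff_modulate hφ hg s)
  have hf : ⇑f = modulate φ s g := rfl
  have hfM : eLpNorm f 2 volume = M := by rw [hf, eLpNorm_modulate]
  have hbound : eLpNorm (Δ f : 𝓢(E, ℂ)) 2 volume ≤ ENNReal.ofReal (K * s ^ 2) * (M / 4) := by
    -- The first part is `O(s)`; the second is `s²` times a function with the modulus of `G = |∇φ|²
    -- g`.
    have e : ⇑(Δ f : 𝓢(E, ℂ)) = (fun η => (Δ f) η + s ^ 2 * ∑ i, ((fderiv ℝ φ η (b i)) : ℂ) ^ 2 * f η) -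
        ((s : ℂ) ^ 2) • modulate φ s G := by
      ext η
      simp only [Pi.sub_apply, Pi.smul_apply, smul_eq_mul, hf, hG, modulate]
      rw [eq_sub_iff_add_eq, Finset.mul_sum _ _ (Complex.exp _)]
      congr 2
      exact Finset.sum_congr rfl fun i _ => by ring
    have hm2 : eLpNorm (modulate φ s G) 2 volume = eLpNorm G 2 volume := eLpNorm_modulate ..
    have hGms : AEStronglyMeasurable (modulate φ s G) volume := by
      refine AEStronglyMeasurable.mul (Continuous.aestronglyMeasurable ?_) hGm.1
      have := hφ.continuous
      fun_prop
    have hms : AEStronglyMeasurable (fun η => (Δ f) η +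
        s ^ 2 * ∑ i, ((fderiv ℝ φ η (b i)) : ℂ) ^ 2 * f η) volume := by
      have : (fun η => (Δ f) η + s ^ 2 * ∑ i, ((fderiv ℝ φ η (b i)) : ℂ) ^ 2 * f η) =
          ⇑(Δ f : 𝓢(E, ℂ)) + ((s : ℂ) ^ 2) • modulate φ s G := by
        nth_rewrite 2 [e]
        rw [sub_add_cancel]
      rw [this]
      exact (Δ f : 𝓢(E, ℂ)).continuous.aestronglyMeasurable.add (hGms.const_smul _)
    rw [e]
    refine (eLpNorm_sub_le hms (hGms.const_smul _) (by norm_num)).trans ?_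
    rw [eLpNorm_const_smul, hm2]
    calc _ ≤ C * ENNReal.ofReal (s ^ 2) + ENNReal.ofReal (s ^ 2) * eLpNorm G 2 volume := by
          gcongr
          · exact (hC s hs f hf).trans (by gcongr; nlinarith)
          · rw [← ofReal_norm, norm_pow, Complex.norm_real, Real.norm_of_nonneg hs0.le]
      _ = (C + eLpNorm G 2 volume) * ENNReal.ofReal (s ^ 2) := by ring
      _ ≤ (ENNReal.ofReal K * (M / 4)) * ENNReal.ofReal (s ^ 2) := by gcongr
      _ = _ := by rw [ENNReal.ofReal_mul (by linarith)]; ring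
  have key := half_eLpNorm_le_of_multiplier (f := f) (f₀ := f) (u := Δ f)
    (P := fun w => -(4 * Real.pi ^ 2 * ‖w‖ ^ 2)) (by fun_prop)
    (fun w => by rw [fourier_laplacian_apply]; push_cast; rfl) (L := K * s ^ 2) (by positivity)
    (by simp) (by rwa [hfM]) hq
  rw [hfM] at key
  refine hNM.trans (key.trans ?_)
  rw [SchwartzMap.fourier_coe, hf]
  refine mul_le_mul_right (ENNReal.rpow_le_rpow ?_ (half_sub_one_div_toReal_nonneg hq)) _
  -- Here `4π² ≥ 1`, and `K ≥ 1` allows `√K` to be replaced by `K` in the radius.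
  calc volume {w : E | |-(4 * Real.pi ^ 2 * ‖w‖ ^ 2)| < K * s ^ 2}
      ≤ volume (Metric.closedBall (0 : E) (K * s)) := by
        refine measure_mono fun w hw => ?_
        rw [mem_closedBall_zero_iff]
        simp only [Set.mem_ofPred_eq, abs_neg] at hw
        rw [abs_of_nonneg (by positivity)] at hw
        have hpi := Real.pi_gt_three
        refine abs_le_of_sq_le_sq' ?_ (by positivity) |>.2
        have h1 : ‖w‖ ^ 2 ≤ 4 * Real.pi ^ 2 * ‖w‖ ^ 2 :=
          le_mul_of_one_le_left (by positivity) (by nlinarith)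
        nlinarith [mul_le_mul_of_nonneg_right hK1 (by positivity : 0 ≤ K * s ^ 2)]
    _ = _ := by
        rw [Measure.addHaar_closedBall _ _ (by positivity), mul_right_comm,
          ENNReal.ofReal_mul (by positivity), ENNReal.ofReal_toReal hvT, ← mul_pow]

end Concentration

/-! ### Concentration near the light cone -/

section Cone

variable {E : Type*} [NormedAddCommGroup E] [InnerProductSpace ℝ E]

/-- The phase `√(|η|² + m²)` of the hyperboloid of mass `m`. -/
def massPhase {E : Type*} [NormedAddCommGroup E] (m : ℝ) (η : E) : ℝ :=
  Real.sqrt (‖η‖ ^ 2 + m ^ 2)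

theorem contDiff_massPhase {m : ℝ} (hm : m ≠ 0) : ContDiff ℝ ∞ (massPhase m : E → ℝ) :=
  ((contDiff_norm_sq ℝ).add contDiff_const).sqrt fun η => by positivity

/-- The difference is `m² / (√(|η|² + m²) + |η|)`. At time `s` the phase error between hyperboloid
and cone is thus at most `s m²`. -/
theorem abs_massPhase_sub_norm_le {E : Type*} [NormedAddCommGroup E] {m : ℝ} {η : E}
    (hη : 1 ≤ ‖η‖) : |massPhase m η - ‖η‖| ≤ m ^ 2 := by
  have h1 : ‖η‖ ≤ massPhase m η := Real.le_sqrt_of_sq_le (by nlinarith [sq_nonneg m])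
  have h2 : massPhase m η ^ 2 = ‖η‖ ^ 2 + m ^ 2 := Real.sq_sqrt (by positivity)
  rw [abs_of_nonneg (by linarith)]
  nlinarith

variable [FiniteDimensional ℝ E]

/-- A smooth function on `E` that agrees with the norm away from the origin. -/
theorem exists_smooth_eq_norm : ∃ φ : E → ℝ, ContDiff ℝ ∞ φ ∧ ∀ η, 1 / 2 < ‖η‖ → φ η = ‖η‖ := by
  let β : ContDiffBump (0 : E) := ⟨1 / 4, 1 / 2, by norm_num, by norm_num⟩
  refine ⟨fun η => Real.sqrt (‖η‖ ^ 2 + β η), ((contDiff_norm_sq ℝ).add β.contDiff).sqrt ?_, ?_⟩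
  · intro η
    rcases eq_or_ne η 0 with rfl | h
    · rw [β.one_of_mem_closedBall (Metric.mem_closedBall_self (by norm_num))]
      norm_num
    · have := norm_pos_iff.2 h
      have := β.nonneg (x := η)
      positivity
  · intro η hη
    have : β η = 0 := β.zero_of_le_dist (by rw [dist_zero_right]; exact hη.le)
    simp only [this, add_zero, Real.sqrt_sq (norm_nonneg η)]

/-- The eikonal equation `|∇φ| = 1`, by differentiating `φ² = |η|²` to get `φ ∇φ = η`. It turns the
`s²` term of `Δ(e^{isφ}g)` into exactly `-s² e^{isφ}g`. -/
theorem sum_fderiv_sq_eq_one {φ : E → ℝ} (hφ : ContDiff ℝ ∞ φ)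
    (hφn : ∀ η, 1 / 2 < ‖η‖ → φ η = ‖η‖) {η : E} (hη : 1 ≤ ‖η‖) :
    ∑ i, (fderiv ℝ φ η (stdOrthonormalBasis ℝ E i)) ^ 2 = 1 := by
  have h1 : HasFDerivAt φ (fderiv ℝ φ η) η := (hφ.differentiable (by simp) η).hasFDerivAt
  have h2 : HasFDerivAt (fun x => ‖x‖ ^ 2) ((2 * φ η) • fderiv ℝ φ η) η := by
    have := (h1.pow 2)
    refine (this.congr_of_eventuallyEq ?_).congr_fderiv (by simp)
    filter_upwards [(isOpen_lt continuous_const continuous_norm).mem_nhds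
      (show 1 / 2 < ‖η‖ by linarith)] with x hx
    simp [hφn x hx]
  have h3 := h2.unique (hasStrictFDerivAt_norm_sq η).hasFDerivAt
  have h4 : ∀ v, φ η * fderiv ℝ φ η v = inner ℝ η v := fun v => by
    have := congrArg (fun L : E →L[ℝ] ℝ => L v) h3
    simp only [smul_apply, smul_eq_mul, innerSL_apply_apply, nsmul_eq_mul,
      Nat.cast_ofNat] at this
    linarith
  have h5 : ‖η‖ ^ 2 * ∑ i, (fderiv ℝ φ η (stdOrthonormalBasis ℝ E i)) ^ 2 = ‖η‖ ^ 2 * 1 := by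
    rw [mul_one, Finset.mul_sum]
    conv_rhs => rw [← (stdOrthonormalBasis ℝ E).sum_sq_norm_inner_left η]
    refine Finset.sum_congr rfl fun i _ => ?_
    rw [← h4, hφn η (by linarith), Real.norm_eq_abs, sq_abs, mul_pow]
  exact mul_left_cancel₀ (by positivity) h5

theorem norm_exp_I_mul_sub_exp_I_mul_le (a b : ℝ) :
    ‖Complex.exp (Complex.I * (a : ℂ)) - Complex.exp (Complex.I * (b : ℂ))‖ ≤ |a - b| := by
  have : Complex.exp (Complex.I * (a : ℂ)) - Complex.exp (Complex.I * (b : ℂ)) =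
      Complex.exp (Complex.I * (b : ℂ)) * (Complex.exp (Complex.I * ((a - b : ℝ) : ℂ)) - 1) := by
    rw [mul_sub, ← Complex.exp_add, mul_one]
    push_cast
    ring_nf
  rw [this, norm_mul, mul_comm Complex.I, Complex.norm_exp_ofReal_mul_I, one_mul]
  exact Real.norm_exp_I_mul_ofReal_sub_one_le

variable [MeasurableSpace E] [BorelSpace E]

/-- Factoring `s² - 4π²|w|² = (s - 2π|w|)(s + 2π|w|)`, whose second factor is at least `s`, gives
`|s - 2π|w|| < K`: a shell of bounded thickness and radius `O(s)`. The inner radius is cut off at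
zero for `s < K`. -/
theorem exists_volume_annulus_le [Nontrivial E] {K : ℝ} (hK : 1 ≤ K) :
    ∃ V : ℝ, 0 < V ∧ ∀ s : ℝ, 1 ≤ s →
      volume {w : E | |s ^ 2 - 4 * Real.pi ^ 2 * ‖w‖ ^ 2| < K * s} ≤
        ENNReal.ofReal (V * s ^ (Module.finrank ℝ E - 1)) := by
  set n := Module.finrank ℝ E with hn
  have hn0 : 0 < n := Module.finrank_pos
  set v := volume (Metric.ball (0 : E) 1)
  have hv0 : v ≠ 0 := (Metric.measure_ball_pos _ _ one_pos).ne'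
  have hvT : v ≠ ⊤ := measure_ball_lt_top.ne
  have hvpos := ENNReal.toReal_pos hv0 hvT
  have hpi := Real.pi_gt_three
  refine ⟨2 * K * n * (1 + K) ^ (n - 1) * v.toReal, by positivity, fun s hs => ?_⟩
  set r₁ := (s + K) / (2 * Real.pi) with hr1
  set r₂ := max (s - K) 0 / (2 * Real.pi) with hr2
  have hr20 : 0 ≤ r₂ := by positivity
  have hr12 : r₂ ≤ r₁ := by
    rw [hr1, hr2]; gcongr; exact max_le (by linarith) (by linarith)
  have hsub : {w : E | |s ^ 2 - 4 * Real.pi ^ 2 * ‖w‖ ^ 2| < K * s} ⊆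
      Metric.closedBall 0 r₁ \ Metric.ball 0 r₂ := by
    intro w hw
    rw [Set.mem_ofPred_eq] at hw
    obtain ⟨hw1, hw2⟩ := abs_lt.1 hw
    refine ⟨?_, ?_⟩
    · rw [mem_closedBall_zero_iff, hr1, le_div_iff₀ (by positivity)]
      refine abs_le_of_sq_le_sq' ?_ (by positivity) |>.2
      nlinarith
    · rw [mem_ball_zero_iff, not_lt, hr2, div_le_iff₀ (by positivity)]
      refine max_le ?_ (by positivity)
      rcases le_or_gt s K with h | h
      · have : 0 ≤ ‖w‖ * (2 * Real.pi) := by positivity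
        linarith
      · refine abs_le_of_sq_le_sq' ?_ (by positivity) |>.2
        nlinarith
  refine (measure_mono hsub).trans ?_
  rw [measure_sdiff (Metric.ball_subset_closedBall.trans (Metric.closedBall_subset_closedBall hr12))
    Metric.isOpen_ball.measurableSet.nullMeasurableSet measure_ball_lt_top.ne,
    Measure.addHaar_closedBall _ _ (hr20.trans hr12), Measure.addHaar_ball _ _ hr20,
    ← ENNReal.sub_mul (fun _ _ => hvT), ← ENNReal.ofReal_sub _ (by positivity),
    ← hn]
  nth_rewrite 1 [← ENNReal.ofReal_toReal hvT]
  rw [← ENNReal.ofReal_mul' hvpos.le]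
  refine ENNReal.ofReal_le_ofReal ?_
  have h1 : r₁ ^ n - r₂ ^ n ≤ (r₁ - r₂) * n * r₁ ^ (n - 1) := by
    have := abs_pow_sub_pow_le r₁ r₂ n
    rwa [abs_of_nonneg (hr20.trans hr12), abs_of_nonneg hr20, max_eq_left hr12,
      abs_of_nonneg (by linarith [hr12] : 0 ≤ r₁ - r₂),
      abs_of_nonneg (sub_nonneg.2 (pow_le_pow_left₀ hr20 hr12 n))] at this
  have h2 : r₁ - r₂ ≤ 2 * K := by
    rw [hr1, hr2, ← sub_div, div_le_iff₀ (by positivity)]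
    have := le_max_left (s - K) 0
    nlinarith
  have h3 : r₁ ≤ (1 + K) * s := by
    rw [hr1, div_le_iff₀ (by positivity)]
    have : s + K ≤ (1 + K) * s := by nlinarith
    nlinarith [show 0 ≤ (1 + K) * s by positivity]
  calc (r₁ ^ n - r₂ ^ n) * v.toReal ≤ (2 * K * n * ((1 + K) * s) ^ (n - 1)) * v.toReal := by
        gcongr
        refine h1.trans ?_
        have := hr20.trans hr12
        gcongr
    _ = _ := by rw [mul_pow]; ring

/-- Wave concentration: for frequencies of size one and mass `m`, up to times `s ≲ m⁻²`, the wave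
`𝓕 (e^{i s φ} g)` lives in an annulus of thickness one around the light cone. -/
theorem exists_le_eLpNorm_fourier_modulate_massPhase [Nontrivial E] {g : E → ℂ}
    (hg : ContDiff ℝ ∞ g) (hgc : HasCompactSupport g) (h0 : g ≠ 0)
    (hsupp : ∀ η, g η ≠ 0 → 1 ≤ ‖η‖) :
    ∃ N V : ℝ, 0 < N ∧ 0 < V ∧ ∀ s : ℝ, 1 ≤ s → ∀ m : ℝ, 0 < m → s * m ^ 2 ≤ 1 / 4 →
      ∀ q : ℝ≥0∞, 2 ≤ q →
      ENNReal.ofReal N ≤ eLpNorm (𝓕 (modulate (massPhase m) s g)) q volume *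
        ENNReal.ofReal (V * s ^ (Module.finrank ℝ E - 1)) ^ (1 / 2 - 1 / q.toReal) := by
  -- All constants come from this massless phase and are therefore uniform in `m`; the mass enters
  -- only through `f - f₀`.
  obtain ⟨φ, hφ, hφn⟩ := exists_smooth_eq_norm (E := E)
  obtain ⟨C, hC⟩ := exists_eLpNorm_laplacian_modulate_le hφ hg hgc
  set M := eLpNorm g 2 volume with hM
  have hM0 : M ≠ 0 := eLpNorm_two_ne_zero hg.continuous h0
  obtain ⟨K, hK1, hK⟩ := exists_mul_le (C := C) (N := M / 4)
    ENNReal.coe_ne_top (ENNReal.div_ne_zero.2 ⟨hM0, by norm_num⟩)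
  obtain ⟨N, hN, hNM⟩ := exists_pos_ofReal_le (N := M / 2)
    (ENNReal.div_ne_zero.2 ⟨hM0, by norm_num⟩)
  obtain ⟨V, hV, hvol⟩ := exists_volume_annulus_le (E := E) hK1
  refine ⟨N, V, hN, hV, fun s hs m hm hsm q hq => ?_⟩
  have hs0 : 0 < s := by linarith
  set f : 𝓢(E, ℂ) := (hasCompactSupport_modulate hgc (massPhase m) s).toSchwartzMap
    (contDiff_modulate (contDiff_massPhase hm.ne') hg s)
  have hf : ⇑f = modulate (massPhase m) s g := rfl
  set f₀ : 𝓢(E, ℂ) := (hasCompactSupport_modulate hgc φ s).toSchwartzMap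
    (contDiff_modulate hφ hg s)
  have hf₀ : ⇑f₀ = modulate φ s g := rfl
  have hfM : eLpNorm f 2 volume = M := by rw [hf, eLpNorm_modulate]
  -- Its Fourier multiplier is `s² - 4π²|w|²`, and by the eikonal equation it is the `O(s)`
  -- remainder.
  set u : 𝓢(E, ℂ) := Δ f₀ + ((s ^ 2 : ℝ) : ℂ) • f₀
  have hu : eLpNorm u 2 volume ≤ ENNReal.ofReal (K * s) * (M / 4) := by
    have e : ⇑u = fun η => (Δ f₀) η +
        s ^ 2 * ∑ i, ((fderiv ℝ φ η (stdOrthonormalBasis ℝ E i)) : ℂ) ^ 2 * f₀ η := by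
      ext η
      change (Δ f₀) η + ((s ^ 2 : ℝ) : ℂ) * f₀ η = _
      rw [← Finset.sum_mul]
      by_cases hη : g η = 0
      · simp [hf₀, modulate, hη]
      · have := sum_fderiv_sq_eq_one hφ hφn (hsupp η hη)
        have h1 : ∑ i, ((fderiv ℝ φ η (stdOrthonormalBasis ℝ E i)) : ℂ) ^ 2 = 1 := by
          exact_mod_cast this
        rw [h1]
        push_cast
        ring
    rw [e]
    refine (hC s hs f₀ hf₀).trans ?_
    rw [ENNReal.ofReal_mul (by linarith), mul_right_comm]
    gcongr
  -- Pointwise `|f - f₀| ≤ s m² |f|`; hence the condition `s m² ≤ 1/4`.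
  have hsub : eLpNorm (f - f₀ : 𝓢(E, ℂ)) 2 volume ≤ eLpNorm f 2 volume / 4 := by
    calc eLpNorm (f - f₀ : 𝓢(E, ℂ)) 2 volume ≤ eLpNorm ((1 / 4 : ℝ) • f) 2 volume := by
          refine eLpNorm_mono fun η => ?_
          change ‖f η - f₀ η‖ ≤ ‖(1 / 4 : ℝ) • f η‖
          rw [norm_smul, hf, hf₀, norm_modulate, modulate, modulate, ← sub_mul, norm_mul]
          by_cases hη : g η = 0
          · simp [hη]
          · have h1 := hsupp η hη
            refine mul_le_mul_of_nonneg_right ?_ (norm_nonneg _)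
            refine (norm_exp_I_mul_sub_exp_I_mul_le _ _).trans ?_
            rw [← mul_sub, abs_mul, abs_of_pos hs0, hφn η (by linarith),
              Real.norm_of_nonneg (by norm_num)]
            exact (mul_le_mul_of_nonneg_left (abs_massPhase_sub_norm_le h1) hs0.le).trans hsm
      _ = _ := by
          rw [show ⇑((1 / 4 : ℝ) • f) = (1 / 4 : ℝ) • ⇑f from rfl, eLpNorm_const_smul,
            Real.enorm_of_nonneg (by norm_num), ENNReal.ofReal_div_of_pos (by norm_num),
            mul_comm, ENNReal.div_eq_inv_mul, ENNReal.div_eq_inv_mul]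
          simp [mul_comm]
  have key := half_eLpNorm_le_of_multiplier (f := f) (f₀ := f₀) (u := u)
    (P := fun w => s ^ 2 - 4 * Real.pi ^ 2 * ‖w‖ ^ 2) (by fun_prop)
    (fun w => by
      have : (𝓕 u : 𝓢(E, ℂ)) = 𝓕 (Δ f₀) + ((s ^ 2 : ℝ) : ℂ) • 𝓕 f₀ := by
        rw [FourierTransform.fourier_add, FourierTransform.fourier_smul]
      rw [this]
      change (𝓕 (Δ f₀) : 𝓢(E, ℂ)) w + ((s ^ 2 : ℝ) : ℂ) * (𝓕 f₀ : 𝓢(E, ℂ)) w = _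
      rw [fourier_laplacian_apply]
      push_cast
      ring) (L := K * s) (by positivity) hsub (by rwa [hfM]) hq
  rw [hfM] at key
  refine hNM.trans (key.trans ?_)
  rw [SchwartzMap.fourier_coe, hf]
  exact mul_le_mul_right (ENNReal.rpow_le_rpow (hvol s hs)
    (half_sub_one_div_toReal_nonneg hq)) _

end Cone

/-! ### Transfer to the hyperboloid, and norms of the test functions -/

/-- The function `⟨ξ⟩ g(ξ)` on the hyperboloid, whose density with respect to `dξ` is `g`. -/
def lift {d : ℕ} (g : EuclideanSpace ℝ (Fin d) → ℂ) (w : upperSheet d) : ℂ :=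
  (bracket w.1.2 : ℂ) * g w.1.2

theorem param_eq {d : ℕ} (w : upperSheet d) : param d w.1.2 = w :=
  Subtype.ext (Prod.ext w.2.symm rfl)

variable {d : ℕ}

local notation "V" => EuclideanSpace ℝ (Fin d)

theorem continuous_lift {g : V → ℂ} (hg : Continuous g) : Continuous (lift g) :=
  (Complex.continuous_ofReal.comp (continuous_bracket.comp
    (continuous_snd.comp continuous_subtype_val))).mul
    (hg.comp (continuous_snd.comp continuous_subtype_val))

theorem hasCompactSupport_lift {g : V → ℂ} (hg : HasCompactSupport g) :
    HasCompactSupport (lift g) := by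
  refine HasCompactSupport.intro (hg.isCompact.image (continuous_param d)) fun w hw => ?_
  rw [lift, image_eq_zero_of_notMem_tsupport (f := g) fun h => hw ⟨_, h, param_eq w⟩, mul_zero]

theorem extension_lift {g : V → ℂ} (hg : Continuous g) (z : ℝ × V) :
    extension d (lift g) z =
      ∫ ξ, Complex.exp (Complex.I * ((z.1 * bracket ξ + inner ℝ z.2 ξ : ℝ) : ℂ)) * g ξ := by
  have hc : Continuous fun w : upperSheet d =>
      Complex.exp (Complex.I * ((z.1 * w.1.1 + inner ℝ z.2 w.1.2 : ℝ) : ℂ)) * lift g w := by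
    refine Continuous.mul ?_ (continuous_lift hg)
    have h1 : Continuous fun w : upperSheet d => w.1.1 := continuous_fst.comp continuous_subtype_val
    have h2 : Continuous fun w : upperSheet d => w.1.2 := continuous_snd.comp continuous_subtype_val
    fun_prop
  rw [extension, integral_lorentzMeasure d _ hc]
  refine integral_congr_ae (Filter.Eventually.of_forall fun ξ => ?_)
  have : (bracket ξ : ℂ) ≠ 0 := by
    exact_mod_cast (zero_lt_one.trans_le (one_le_bracket ξ)).ne'
  simp only [lift, param]
  field_simp

theorem bracket_smul {R : ℝ} (hR : 0 < R) (η : V) :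
    bracket (R • η) = R * massPhase R⁻¹ η := by
  rw [bracket, massPhase, norm_smul, Real.norm_of_nonneg hR.le]
  nth_rewrite 2 [← Real.sqrt_sq hR.le]
  rw [← Real.sqrt_mul (by positivity)]
  congr 1
  field_simp

/-- The substitution `ξ = Rη` changes mass `1` into `R⁻¹` and time `t` into `Rt`. The point `x =
-(2π/R) w` matches the kernel `e^{-2πi⟨η,w⟩}` of `𝓕`. -/
theorem extension_lift_dilate {g : V → ℂ} (hg : Continuous g) {R : ℝ} (hR : 0 < R) (t : ℝ) (w : V) :
    extension d (lift fun ξ => g (R⁻¹ • ξ)) (t, (-(2 * Real.pi / R)) • w) =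
      (R : ℂ) ^ d * 𝓕 (modulate (massPhase R⁻¹) (R * t) g) w := by
  rw [extension_lift (by fun_prop : Continuous fun ξ => g (R⁻¹ • ξ))]
  set G : V → ℂ := fun η => Complex.exp (Complex.I * ((t * bracket (R • η) +
    inner ℝ ((-(2 * Real.pi / R)) • w) (R • η) : ℝ) : ℂ)) * g η with hG
  have h1 := Measure.integral_comp_inv_smul_of_nonneg volume G hR.le
  simp only [hG, smul_inv_smul₀ hR.ne'] at h1
  rw [h1, finrank_euclideanSpace_fin, Complex.real_smul, Complex.ofReal_pow,
    Real.fourier_eq']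
  congr 1
  refine integral_congr_ae (Filter.Eventually.of_forall fun η => ?_)
  simp only [modulate, smul_eq_mul]
  rw [← mul_assoc, ← Complex.exp_add, bracket_smul hR, inner_smul_left, inner_smul_right,
    real_inner_comm]
  congr 2
  simp only [conj_trivial, neg_mul]
  rw [show 2 * Real.pi / R * (R * inner ℝ η w) = 2 * Real.pi * inner ℝ η w by field_simp]
  push_cast
  ring

theorem eLpNorm_comp_smul {E : Type*} [NormedAddCommGroup E] [NormedSpace ℝ E]
    [FiniteDimensional ℝ E] [MeasurableSpace E] [BorelSpace E] (μ : Measure E)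
    [μ.IsAddHaarMeasure] (f : E → ℂ) {r : ℝ} (hr : r ≠ 0) (q : ℝ≥0∞) :
    eLpNorm (fun x => f (r • x)) q μ =
      ENNReal.ofReal |(r ^ Module.finrank ℝ E)⁻¹| ^ (1 / q.toReal) * eLpNorm f q μ := by
  have h := (Homeomorph.smulOfNeZero r hr (α := E)).measurableEmbedding.eLpNorm_map_measure
    (μ := μ) (p := q) (g := f)
  have h2 : μ.map (Homeomorph.smulOfNeZero r hr (α := E)) = _ := Measure.map_addHaar_smul μ hr
  rw [h2, eLpNorm_smul_measure_of_ne_zero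
    (by simpa using pow_pos (abs_pos.2 hr) _), smul_eq_mul] at h
  rw [ENNReal.toReal_div, ENNReal.toReal_one] at h
  exact h.symm

/-- Tonelli in time: it turns fixed-time lower bounds into space-time ones. -/
theorem lintegral_rpow_le_eLpNorm_rpow {E : Type*} [MeasureSpace E] [SFinite (volume : Measure E)]
    {F : ℝ × E → ℂ}
    (hF : AEStronglyMeasurable F volume) {q : ℝ≥0∞} (hq0 : q ≠ 0) (hqT : q ≠ ⊤) {J : Set ℝ}
    (hJ : MeasurableSet J) {k : ℝ → ℝ≥0∞}
    (hk : ∀ t ∈ J, k t ≤ eLpNorm (fun x => F (t, x)) q volume) :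
    ∫⁻ t in J, k t ^ q.toReal ≤ eLpNorm F q volume ^ q.toReal := by
  have hq := ENNReal.toReal_pos hq0 hqT
  have hpow : ∀ {α : Type _} [MeasurableSpace α] (μ : Measure α) (f : α → ℂ),
      eLpNorm f q μ ^ q.toReal = ∫⁻ x, ‖f x‖ₑ ^ q.toReal ∂μ := fun μ f => by
    rw [eLpNorm_eq_lintegral_rpow_enorm_toReal hq0 hqT, ← ENNReal.rpow_mul,
      one_div_mul_cancel hq.ne', ENNReal.rpow_one]
  rw [eLpNorm_eq_lintegral_rpow_enorm_toReal hq0 hqT, ← ENNReal.rpow_mul,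
      one_div_mul_cancel hq.ne', ENNReal.rpow_one, Measure.volume_eq_prod,
    lintegral_prod _ (hF.enorm.pow_const _)]
  refine (setLIntegral_mono' hJ fun t ht => ?_).trans (setLIntegral_le_lintegral J _)
  rw [← hpow]
  exact ENNReal.rpow_le_rpow (hk t ht) hq.le

/-- Measurability is inherited from the `L^q` class that agrees a.e. with `extension d f`; Tonelli
needs it later. -/
theorem exists_bound_of_extensionEstimate {p q : ℝ≥0∞} [Fact (1 ≤ p)] [Fact (1 ≤ q)]
    (h : ExtensionEstimate d p q) : ∃ C : ℝ≥0, ∀ f : upperSheet d → ℂ, Continuous f →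
      HasCompactSupport f → AEStronglyMeasurable (extension d f) volume ∧
        eLpNorm (extension d f) q volume ≤ C * eLpNorm f p (lorentzMeasure d) := by
  obtain ⟨T, hT⟩ := h
  refine ⟨‖T‖₊, fun f hf hfc => ?_⟩
  have hae := hT f hf hfc
  refine ⟨(Lp.aestronglyMeasurable _).congr hae, ?_⟩
  rw [← eLpNorm_congr_ae hae, ← Lp.enorm_def]
  refine (T.le_opENorm _).trans (le_of_eq ?_)
  rw [Lp.enorm_toLp]
  rfl

/-- The function is bounded by `B` and lives over `A`, where the density `1/⟨ξ⟩` is at most `1/b`.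
For `p = ∞`, `1 / p.toReal` is `0` by convention, which is the correct exponent here and below. -/
theorem eLpNorm_lift_le {g : V → ℂ} (hg : Continuous g) {A : Set V} (hAm : MeasurableSet A)
    {B b : ℝ} (hb : 0 < b) (hB : ∀ ξ, bracket ξ * ‖g ξ‖ ≤ B) (hA : ∀ ξ, g ξ ≠ 0 → ξ ∈ A)
    (hbA : ∀ ξ ∈ A, b ≤ bracket ξ) (p : ℝ≥0∞) :
    eLpNorm (lift g) p (lorentzMeasure d) ≤
      ENNReal.ofReal B * (ENNReal.ofReal (1 / b) * volume A) ^ (1 / p.toReal) := by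
  have hB0 : 0 ≤ B := (mul_nonneg (zero_le_one.trans (one_le_bracket 0)) (norm_nonneg _)).trans (hB 0)
  rw [lorentzMeasure, eLpNorm_map_measure (continuous_lift hg).aestronglyMeasurable
    (continuous_param d).aemeasurable]
  refine (eLpNorm_mono_enorm (g := A.indicator fun _ => B) fun ξ => ?_).trans
    ((eLpNorm_indicator_const_le B p).trans ?_)
  · by_cases h : ξ ∈ A
    · rw [Set.indicator_of_mem h, ← ofReal_norm, ← ofReal_norm, Real.norm_of_nonneg hB0]
      refine ENNReal.ofReal_le_ofReal ?_
      simp only [Function.comp, lift, param, norm_mul, Complex.norm_real]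
      rw [Real.norm_of_nonneg (zero_le_one.trans (one_le_bracket ξ))]
      exact hB ξ
    · have : g ξ = 0 := by_contra fun h' => h (hA ξ h')
      simp [lift, param, this]
  · rw [Real.enorm_of_nonneg hB0]
    gcongr
    rw [withDensity_apply _ hAm]
    refine (setLIntegral_mono' hAm (g := fun _ => ENNReal.ofReal (1 / b)) fun ξ hξ => ?_).trans ?_
    · refine ENNReal.ofReal_le_ofReal (one_div_le_one_div_of_le hb (hbA ξ hξ))
    · rw [setLIntegral_const]

/-- No cancellation: after removing the constant factor `e^{iθ₀}`, the real part of the exponential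
is at least `1 - 1/2`, by `cos x ≥ 1 - x²/2`. -/
theorem half_integral_le_norm_integral_exp {α : Type*} [MeasurableSpace α] {μ : Measure α}
    {g θ : α → ℝ} (hg : Integrable g μ) (hθ : AEStronglyMeasurable θ μ) (hg0 : ∀ x, 0 ≤ g x)
    (θ₀ : ℝ) (h : ∀ x, g x ≠ 0 → |θ x - θ₀| ≤ 1) :
    1 / 2 * ∫ x, g x ∂μ ≤ ‖∫ x, Complex.exp (Complex.I * (θ x : ℂ)) * (g x : ℂ) ∂μ‖ := by
  have hnorm : ∀ x : ℝ, ‖Complex.exp (Complex.I * (x : ℂ))‖ = 1 := fun x => by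
    rw [mul_comm, Complex.norm_exp_ofReal_mul_I]
  have e : ∫ x, Complex.exp (Complex.I * ((θ x - θ₀ : ℝ) : ℂ)) * (g x : ℂ) ∂μ =
      Complex.exp (Complex.I * ((-θ₀ : ℝ) : ℂ)) *
        ∫ x, Complex.exp (Complex.I * (θ x : ℂ)) * (g x : ℂ) ∂μ := by
    rw [← integral_const_mul]
    refine integral_congr_ae (Filter.Eventually.of_forall fun x => ?_)
    simp only
    rw [← mul_assoc, ← Complex.exp_add]
    push_cast
    ring_nf
  have hi : Integrable (fun x => Complex.exp (Complex.I * ((θ x - θ₀ : ℝ) : ℂ)) * (g x : ℂ)) μ := by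
    refine (hg.ofReal (𝕜 := ℂ)).bdd_mul (c := 1) ?_ (Filter.Eventually.of_forall fun x => (hnorm _).le)
    have : Continuous fun y : ℝ => Complex.exp (Complex.I * (y : ℂ)) := by fun_prop
    exact this.comp_aestronglyMeasurable (hθ.sub aestronglyMeasurable_const)
  calc 1 / 2 * ∫ x, g x ∂μ = ∫ x, 1 / 2 * g x ∂μ := (integral_const_mul _ _).symm
    _ ≤ ∫ x, (Complex.exp (Complex.I * ((θ x - θ₀ : ℝ) : ℂ)) * (g x : ℂ)).re ∂μ := by
        refine integral_mono (hg.const_mul _) hi.re fun x => ?_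
        simp only [Complex.re_mul_ofReal, mul_comm Complex.I, Complex.exp_ofReal_mul_I_re]
        by_cases hx : g x = 0
        · simp [hx]
        · refine mul_le_mul_of_nonneg_right ?_ (hg0 x)
          have h1 := Real.one_sub_sq_div_two_le_cos (x := θ x - θ₀)
          have h2 : (θ x - θ₀) ^ 2 ≤ 1 := (sq_le_one_iff_abs_le_one _).2 (h x hx)
          linarith
    _ = (∫ x, Complex.exp (Complex.I * ((θ x - θ₀ : ℝ) : ℂ)) * (g x : ℂ) ∂μ).re :=
        integral_re hi
    _ ≤ ‖∫ x, Complex.exp (Complex.I * ((θ x - θ₀ : ℝ) : ℂ)) * (g x : ℂ) ∂μ‖ :=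
        Complex.re_le_norm _
    _ = _ := by rw [e, norm_mul, hnorm, one_mul]

theorem toReal_volume_unitBall_pos : 0 < (volume (Metric.ball (0 : V) 1)).toReal :=
  ENNReal.toReal_pos (Metric.measure_ball_pos _ _ one_pos).ne' measure_ball_lt_top.ne

theorem volume_closedBall_eq {r : ℝ} (hr : 0 ≤ r) : volume (Metric.closedBall (0 : V) r) =
    ENNReal.ofReal (r ^ d * (volume (Metric.ball (0 : V) 1)).toReal) := by
  rw [Measure.addHaar_closedBall _ _ hr, finrank_euclideanSpace_fin,
    ENNReal.ofReal_mul (by positivity), ENNReal.ofReal_toReal measure_ball_lt_top.ne]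

theorem le_eLpNorm_of_le_norm_on_prod {F : ℝ × V → ℂ} {a r c : ℝ} (ha : 0 < a) (hr : 0 < r)
    (hc : 0 ≤ c) (hF : ∀ t x, |t| ≤ a → ‖x‖ ≤ r → c ≤ ‖F (t, x)‖) {q : ℝ≥0∞} (hq : q ≠ 0) :
    ENNReal.ofReal (c * (2 * a * (r ^ d * (volume (Metric.ball (0 : V) 1)).toReal)) ^
      (1 / q.toReal)) ≤ eLpNorm F q volume := by
  have hv := toReal_volume_unitBall_pos (d := d)
  set S : Set (ℝ × V) := Set.Icc (-a) a ×ˢ Metric.closedBall 0 r with hS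
  have hSm : MeasurableSet S := measurableSet_Icc.prod Metric.isClosed_closedBall.measurableSet
  have hvol : volume S =
      ENNReal.ofReal (2 * a * (r ^ d * (volume (Metric.ball (0 : V) 1)).toReal)) := by
    rw [hS, Measure.volume_eq_prod, Measure.prod_prod, Real.volume_Icc, volume_closedBall_eq hr.le,
      ← ENNReal.ofReal_mul (by linarith)]
    ring_nf
  have h1 := eLpNorm_indicator_const' (c := c) hSm (p := q) (μ := volume)
    (by rw [hvol]; simpa using by positivity) hq
  rw [ENNReal.ofReal_mul hc, ← ENNReal.ofReal_rpow_of_pos (by positivity), ← hvol,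
    ← Real.enorm_of_nonneg hc, ← h1]
  refine eLpNorm_mono fun z => ?_
  by_cases hz : z ∈ S
  · rw [Set.indicator_of_mem hz, Real.norm_of_nonneg hc]
    exact hF z.1 z.2 (abs_le.2 hz.1) (mem_closedBall_zero_iff.1 hz.2)
  · simp [hz]

theorem le_of_forall_rpow_le {c₁ c₂ α β : ℝ} (hc : 0 < c₁)
    (h : ∀ᶠ R : ℝ in Filter.atTop, c₁ * R ^ α ≤ c₂ * R ^ β) : α ≤ β := by
  by_contra! hlt
  have h1 := (tendsto_rpow_atTop (sub_pos.2 hlt)).const_mul_atTop hc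
  obtain ⟨R, hR1, hR2, hR3⟩ := (h.and ((Filter.eventually_gt_atTop 0).and
    (h1.eventually_gt_atTop c₂))).exists
  have hp : 0 < R ^ β := Real.rpow_pos_of_pos hR2 _
  rw [Real.rpow_sub hR2, ← mul_div_assoc, lt_div_iff₀ hp] at hR3
  linarith

theorem mul_pow_rpow_eq {K R : ℝ} (hK : 0 ≤ K) (hR : 0 ≤ R) (n : ℕ) (a : ℝ) :
    (K * R ^ n) ^ a = K ^ a * R ^ (n * a) := by
  rw [Real.mul_rpow hK (by positivity), ← Real.rpow_natCast, ← Real.rpow_mul hR]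

/-- The amplitude is `⟨ξ⟩ ~ R`, and the support has `μ`-measure of order `R^d / R`. -/
theorem exists_eLpNorm_lift_dilate_le (hd : 1 ≤ d) {g : V → ℂ} (hg : Continuous g)
    (hg1 : ∀ η, ‖g η‖ ≤ 1)
    (hsupp : ∀ η, g η ≠ 0 → 1 ≤ ‖η‖ ∧ ‖η‖ ≤ 3) (p : ℝ≥0∞) :
    ∃ c : ℝ, 0 < c ∧ ∀ R : ℝ, 1 ≤ R → eLpNorm (lift fun ξ => g (R⁻¹ • ξ)) p (lorentzMeasure d) ≤
      ENNReal.ofReal (c * R ^ (1 + (d - 1) * (1 / p.toReal))) := by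
  have hv := toReal_volume_unitBall_pos (d := d)
  set v := (volume (Metric.ball (0 : V) 1)).toReal
  refine ⟨4 * (3 ^ d * v) ^ (1 / p.toReal), by positivity, fun R hR => ?_⟩
  have hR0 : 0 < R := by linarith
  have hs : ∀ ξ : V, g (R⁻¹ • ξ) ≠ 0 → R ≤ ‖ξ‖ ∧ ‖ξ‖ ≤ 3 * R := fun ξ h => by
    have := hsupp _ h
    rw [norm_smul, norm_inv, Real.norm_of_nonneg hR0.le, ← div_eq_inv_mul, le_div_iff₀ hR0,
      div_le_iff₀ hR0] at this
    simpa using this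
  refine (eLpNorm_lift_le (A := {ξ | R ≤ ‖ξ‖} ∩ Metric.closedBall 0 (3 * R)) (B := 4 * R) (b := R)
    (by fun_prop) (((isClosed_le continuous_const continuous_norm).inter
      Metric.isClosed_closedBall).measurableSet) hR0 (fun ξ => ?_)
    (fun ξ h => ⟨(hs ξ h).1, mem_closedBall_zero_iff.2 (hs ξ h).2⟩) (fun ξ hξ => ?_) p).trans ?_
  · by_cases h : g (R⁻¹ • ξ) = 0
    · rw [h, norm_zero, mul_zero]; positivity
    · have h1 : bracket ξ ≤ 4 * R := Real.sqrt_le_iff.2 ⟨by positivity, by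
        nlinarith [(hs ξ h).2, norm_nonneg ξ]⟩
      exact (mul_le_mul h1 (hg1 _) (norm_nonneg _) (by positivity)).trans (by rw [mul_one])
  · exact (show R ≤ ‖ξ‖ from hξ.1).trans (Real.le_sqrt_of_sq_le (by linarith))
  · calc _ ≤ ENNReal.ofReal (4 * R) * (ENNReal.ofReal (1 / R) *
          volume (Metric.closedBall (0 : V) (3 * R))) ^ (1 / p.toReal) := by
          gcongr; exact Set.inter_subset_right
      _ = ENNReal.ofReal (4 * R * (3 ^ d * v * R ^ (d - 1)) ^ (1 / p.toReal)) := by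
          rw [volume_closedBall_eq (by positivity), ← ENNReal.ofReal_mul (by positivity),
            ENNReal.ofReal_rpow_of_pos (by positivity), ← ENNReal.ofReal_mul (by positivity)]
          congr 3
          obtain ⟨n, rfl⟩ : ∃ n, d = n + 1 := ⟨d - 1, by omega⟩
          rw [Nat.add_sub_cancel]
          field_simp
          ring
      _ ≤ _ := by
          refine ENNReal.ofReal_le_ofReal (le_of_eq ?_)
          rw [mul_pow_rpow_eq (by positivity) hR0.le, Real.rpow_add hR0, Real.rpow_one,
            Nat.cast_sub hd, Nat.cast_one]
          ring

theorem exists_eLpNorm_lift_contract_le {g : V → ℂ} (hg : Continuous g) (hg1 : ∀ η, ‖g η‖ ≤ 1)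
    (hsupp : ∀ η, g η ≠ 0 → ‖η‖ ≤ 1) (p : ℝ≥0∞) :
    ∃ c : ℝ, 0 < c ∧ ∀ R : ℝ, 1 ≤ R → eLpNorm (lift fun ξ => g (R • ξ)) p (lorentzMeasure d) ≤
      ENNReal.ofReal (c * R ^ (-(d * (1 / p.toReal)))) := by
  have hv := toReal_volume_unitBall_pos (d := d)
  set v := (volume (Metric.ball (0 : V) 1)).toReal
  refine ⟨2 * v ^ (1 / p.toReal), by positivity, fun R hR => ?_⟩
  have hR0 : 0 < R := by linarith
  have hs : ∀ ξ : V, g (R • ξ) ≠ 0 → ‖ξ‖ ≤ R⁻¹ := fun ξ h => by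
    have := hsupp _ h
    rwa [norm_smul, Real.norm_of_nonneg hR0.le, mul_comm, ← le_div_iff₀ hR0, one_div] at this
  refine (eLpNorm_lift_le (A := Metric.closedBall 0 R⁻¹) (B := 2) (b := 1)
    (by fun_prop) Metric.isClosed_closedBall.measurableSet one_pos (fun ξ => ?_)
    (fun ξ h => mem_closedBall_zero_iff.2 (hs ξ h)) (fun ξ _ => one_le_bracket ξ) p).trans ?_
  · by_cases h : g (R • ξ) = 0
    · rw [h, norm_zero, mul_zero]; positivity
    · have h2 := (hs ξ h).trans (inv_le_one_of_one_le₀ hR)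
      have h1 : bracket ξ ≤ 2 := Real.sqrt_le_iff.2 ⟨by positivity, by
        nlinarith [norm_nonneg ξ]⟩
      exact (mul_le_mul h1 (hg1 _) (norm_nonneg _) (by positivity)).trans (by rw [mul_one])
  · refine le_of_eq ?_
    rw [volume_closedBall_eq (by positivity), ← ENNReal.ofReal_mul (by positivity),
      ENNReal.ofReal_rpow_of_pos (by positivity), ← ENNReal.ofReal_mul (by positivity)]
    congr 1
    rw [div_one, one_mul, mul_comm (R⁻¹ ^ d), mul_pow_rpow_eq hv.le (by positivity),
      Real.inv_rpow hR0.le, ← Real.rpow_neg hR0.le]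
    ring

theorem le_of_ofReal_le_of_bound {q p : ℝ≥0∞} {C : ℝ≥0}
    (hC : ∀ f : upperSheet d → ℂ, Continuous f → HasCompactSupport f →
      AEStronglyMeasurable (extension d f) volume ∧
        eLpNorm (extension d f) q volume ≤ C * eLpNorm f p (lorentzMeasure d))
    {g : V → ℂ} (hg : Continuous g) (hgc : HasCompactSupport g) {x y : ℝ} (hy : 0 ≤ y)
    (hx : ENNReal.ofReal x ≤ eLpNorm (extension d (lift g)) q volume)
    (hxy : eLpNorm (lift g) p (lorentzMeasure d) ≤ ENNReal.ofReal y) : x ≤ C * y := by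
  have := hx.trans ((hC _ (continuous_lift hg) (hasCompactSupport_lift hgc)).2.trans
    (mul_le_mul_right hxy _))
  rw [← ENNReal.ofReal_coe_nnreal, ← ENNReal.ofReal_mul C.coe_nonneg] at this
  exact (ENNReal.ofReal_le_ofReal_iff (mul_nonneg C.coe_nonneg hy)).1 this

theorem norm_extension_lift_ge {g : V → ℝ} (hg : Continuous g) (hgc : HasCompactSupport g)
    (hg0 : ∀ x, 0 ≤ g x) (t : ℝ) (x : V) (θ₀ : ℝ)
    (h : ∀ ξ, g ξ ≠ 0 → |t * bracket ξ + inner ℝ x ξ - θ₀| ≤ 1) :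
    1 / 2 * ∫ ξ, g ξ ≤ ‖extension d (lift fun ξ => (g ξ : ℂ)) (t, x)‖ := by
  rw [extension_lift (by fun_prop)]
  have := continuous_bracket (d := d)
  refine half_integral_le_norm_integral_exp (hg.integrable_of_hasCompactSupport hgc)
    (Continuous.aestronglyMeasurable (by fun_prop)) hg0 θ₀ h

/-! ### Examples without oscillation -/

/-- The Knapp example at low frequency. -/
theorem necessary_low_frequency {p q : ℝ≥0∞} (hq : q ≠ 0) {C : ℝ≥0}
    (hC : ∀ f : upperSheet d → ℂ, Continuous f → HasCompactSupport f →
      AEStronglyMeasurable (extension d f) volume ∧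
        eLpNorm (extension d f) q volume ≤ C * eLpNorm f p (lorentzMeasure d)) :
    d * (1 / p.toReal) ≤ d - (d + 2) * (1 / q.toReal) := by
  let ψ : ContDiffBump (0 : V) := ⟨1 / 2, 1, by norm_num, by norm_num⟩
  have hsupp : ∀ η, ψ η ≠ 0 → ‖η‖ ≤ 1 := fun η h => by
    by_contra! h'
    exact h (ψ.zero_of_le_dist (by rw [dist_zero_right]; exact h'.le))
  obtain ⟨c, hc, hcR⟩ := exists_eLpNorm_lift_contract_le (g := fun η : V => (ψ η : ℂ))
    (Complex.continuous_ofReal.comp ψ.continuous)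
    (fun η => by rw [Complex.norm_real, Real.norm_of_nonneg ψ.nonneg]; exact ψ.le_one)
    (fun η h => hsupp η (by exact_mod_cast h)) p
  have hI : 0 < ∫ η, ψ η := ψ.integral_pos
  have hv := toReal_volume_unitBall_pos (d := d)
  set v := (volume (Metric.ball (0 : V) 1)).toReal
  have key : ∀ᶠ R : ℝ in Filter.atTop,
      ((1 / 2 * ∫ η, ψ η) * (2 * ((1 / 2) ^ d * v)) ^ (1 / q.toReal)) *
        R ^ ((d + 2) * (1 / q.toReal) - d) ≤ (C * c) * R ^ (-(d * (1 / p.toReal))) := by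
    filter_upwards [Filter.eventually_ge_atTop 1] with R hR
    have hR0 : 0 < R := by linarith
    have hcpt : HasCompactSupport fun ξ : V => ψ (R • ξ) := ψ.hasCompactSupport.comp_smul hR0.ne'
    have hcont : Continuous fun ξ : V => ψ (R • ξ) := ψ.continuous.comp (continuous_const_smul R)
    -- With reference phase `t` and `|ξ| ≤ 1/R`, both `t(⟨ξ⟩ - 1)` and `x·ξ` are at most `1/2` in
    -- modulus; the box has volume of order `R^{d+2}`.
    have low : ∀ (t : ℝ) (x : V), |t| ≤ R ^ 2 → ‖x‖ ≤ R / 2 →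
        1 / 2 * ((R ^ d)⁻¹ * ∫ η, ψ η) ≤
          ‖extension d (lift fun ξ => (ψ (R • ξ) : ℂ)) (t, x)‖ := by
      intro t x ht hx
      refine le_trans (le_of_eq ?_) (norm_extension_lift_ge hcont hcpt (fun _ => ψ.nonneg) t x t
        fun ξ hξ => ?_)
      · have := Measure.integral_comp_smul_of_nonneg volume (fun η : V => ψ η) R (hR := hR0.le)
        rw [this, finrank_euclideanSpace_fin, smul_eq_mul]
      · have h1 := hsupp _ hξ
        rw [norm_smul, Real.norm_of_nonneg hR0.le] at h1
        have h2 : bracket ξ - 1 ≤ ‖ξ‖ ^ 2 / 2 := by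
          have : bracket ξ ≤ ‖ξ‖ ^ 2 / 2 + 1 := Real.sqrt_le_iff.2 ⟨by positivity, by
            nlinarith [sq_nonneg (‖ξ‖ ^ 2)]⟩
          linarith
        have h3 := one_le_bracket ξ
        calc |t * bracket ξ + inner ℝ x ξ - t| = |t * (bracket ξ - 1) + inner ℝ x ξ| := by ring_nf
          _ ≤ |t| * (bracket ξ - 1) + ‖x‖ * ‖ξ‖ := by
              refine (abs_add_le _ _).trans (add_le_add ?_ (abs_real_inner_le_norm x ξ))
              rw [abs_mul, abs_of_nonneg (by linarith : 0 ≤ bracket ξ - 1)]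
          _ ≤ R ^ 2 * (‖ξ‖ ^ 2 / 2) + R / 2 * ‖ξ‖ := by gcongr
          _ ≤ 1 := by nlinarith [mul_nonneg hR0.le (norm_nonneg ξ)]
    have lowN := le_eLpNorm_of_le_norm_on_prod (by positivity : 0 < R ^ 2)
      (by positivity : 0 < R / 2) (by positivity) low hq
    have := le_of_ofReal_le_of_bound hC (Complex.continuous_ofReal.comp hcont)
      (hcpt.comp_left (g := fun x : ℝ => (x : ℂ)) Complex.ofReal_zero) (by positivity) lowN (hcR R hR)
    refine le_trans (le_of_eq ?_) (this.trans (le_of_eq (by ring)))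
    rw [show 2 * R ^ 2 * ((R / 2) ^ d * v) = (2 * ((1 / 2) ^ d * v)) * R ^ (d + 2) by
      rw [div_pow, pow_add]; simp only [one_div, inv_pow]; ring,
      mul_pow_rpow_eq (by positivity) hR0.le, Real.rpow_sub hR0, Real.rpow_natCast]
    push_cast
    field_simp
  have := le_of_forall_rpow_le (by positivity) key
  linarith

/-- A bump function of the frequency variable, away from the origin. -/
theorem exists_frequency_bump (hd : 1 ≤ d) : ∃ ψ : V → ℝ, ContDiff ℝ ∞ ψ ∧ HasCompactSupport ψ ∧
    (∀ η, 0 ≤ ψ η) ∧ (∀ η, ψ η ≤ 1) ∧ (∀ η, ψ η ≠ 0 → 1 ≤ ‖η‖ ∧ ‖η‖ ≤ 3) ∧ 0 < ∫ η, ψ η := by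
  set e : V := EuclideanSpace.single ⟨0, hd⟩ 2
  have he : ‖e‖ = 2 := by simp [e]
  let ψ : ContDiffBump e := ⟨1 / 2, 1, by norm_num, by norm_num⟩
  refine ⟨ψ, ψ.contDiff, ψ.hasCompactSupport, fun _ => ψ.nonneg, fun _ => ψ.le_one, fun η h => ?_,
    ψ.integral_pos⟩
  have h1 : ‖η - e‖ ≤ 1 := by
    by_contra! h'
    exact h (ψ.zero_of_le_dist (by rw [dist_eq_norm]; exact h'.le))
  have h2 := norm_le_norm_add_norm_sub' η e
  have h3 := norm_le_norm_add_norm_sub η e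
  constructor <;> linarith

/-- The focusing example at high frequency. -/
theorem necessary_high_frequency (hd : 1 ≤ d) {p q : ℝ≥0∞} (hq : q ≠ 0) {C : ℝ≥0}
    (hC : ∀ f : upperSheet d → ℂ, Continuous f → HasCompactSupport f →
      AEStronglyMeasurable (extension d f) volume ∧
        eLpNorm (extension d f) q volume ≤ C * eLpNorm f p (lorentzMeasure d)) :
    d - (d + 1) * (1 / q.toReal) ≤ 1 + (d - 1) * (1 / p.toReal) := by
  obtain ⟨ψ, hψs, hψc, hψ0, hψ1, hsupp, hI⟩ := exists_frequency_bump hd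
  have hψ := hψs.continuous
  obtain ⟨c, hc, hcR⟩ := exists_eLpNorm_lift_dilate_le hd (g := fun η : V => (ψ η : ℂ))
    (by fun_prop)
    (fun η => by rw [Complex.norm_real, Real.norm_of_nonneg (hψ0 η)]; exact hψ1 η)
    (fun η h => hsupp η (by exact_mod_cast h)) p
  have hv := toReal_volume_unitBall_pos (d := d)
  set v := (volume (Metric.ball (0 : V) 1)).toReal
  refine le_of_forall_rpow_le (c₁ := (1 / 2 * ∫ η, ψ η) *
    (2 * (1 / 8) * ((1 / 8) ^ d * v)) ^ (1 / q.toReal)) (c₂ := C * c) (by positivity) ?_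
  filter_upwards [Filter.eventually_ge_atTop 1] with R hR
  have hR0 : 0 < R := by linarith
  have hcpt : HasCompactSupport fun ξ : V => ψ (R⁻¹ • ξ) :=
    hψc.comp_smul (inv_ne_zero hR0.ne')
  -- Since `⟨ξ⟩ ≤ 4R` and `|ξ| ≤ 3R`, the phase is at most `7/8`.
  have low : ∀ (t : ℝ) (x : V), |t| ≤ 1 / (8 * R) → ‖x‖ ≤ 1 / (8 * R) →
      1 / 2 * (R ^ d * ∫ η, ψ η) ≤
        ‖extension d (lift fun ξ => (ψ (R⁻¹ • ξ) : ℂ)) (t, x)‖ := by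
    intro t x ht hx
    refine le_trans (le_of_eq ?_) (norm_extension_lift_ge (by fun_prop) hcpt (fun _ => hψ0 _) t x 0
      fun ξ hξ => ?_)
    · rw [Measure.integral_comp_inv_smul_of_nonneg volume ψ hR0.le, finrank_euclideanSpace_fin,
        smul_eq_mul]
    · have h1 := (hsupp _ hξ).2
      rw [norm_smul, norm_inv, Real.norm_of_nonneg hR0.le, ← div_eq_inv_mul, div_le_iff₀ hR0] at h1
      have h2 : bracket ξ ≤ 4 * R := Real.sqrt_le_iff.2 ⟨by positivity, by
        nlinarith [norm_nonneg ξ]⟩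
      have h3 := one_le_bracket ξ
      calc |t * bracket ξ + inner ℝ x ξ - 0| ≤ |t| * bracket ξ + ‖x‖ * ‖ξ‖ := by
            rw [sub_zero]
            refine (abs_add_le _ _).trans (add_le_add ?_ (abs_real_inner_le_norm x ξ))
            rw [abs_mul, abs_of_nonneg (by linarith : 0 ≤ bracket ξ)]
        _ ≤ 1 / (8 * R) * (4 * R) + 1 / (8 * R) * (3 * R) := by gcongr
        _ ≤ 1 := by
            rw [← mul_add, one_div_mul_eq_div, div_le_one (by positivity)]
            linarith
  have lowN := le_eLpNorm_of_le_norm_on_prod (by positivity : 0 < 1 / (8 * R))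
    (by positivity : 0 < 1 / (8 * R)) (by positivity) low hq
  have := le_of_ofReal_le_of_bound hC (by fun_prop)
    (hcpt.comp_left (g := fun x : ℝ => (x : ℂ)) Complex.ofReal_zero) (by positivity) lowN (hcR R hR)
  refine le_trans (le_of_eq ?_) (this.trans (le_of_eq (by ring)))
  rw [show 2 * (1 / (8 * R)) * ((1 / (8 * R)) ^ d * v) =
      (2 * (1 / 8) * ((1 / 8) ^ d * v)) * R⁻¹ ^ (d + 1) by
    rw [pow_succ, ← div_div, div_pow (1 / 8), div_eq_mul_inv (1 / 8) R, inv_pow]; ring,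
    mul_pow_rpow_eq (by positivity) (by positivity), Real.inv_rpow hR0.le, Real.rpow_sub hR0,
    Real.rpow_natCast]
  push_cast
  field_simp

/-! ### Time slices and examples with dispersion -/

theorem ofReal_div_le_of_le_mul {a w : ℝ} (hw : 0 < w) {X : ℝ≥0∞}
    (h : ENNReal.ofReal a ≤ X * ENNReal.ofReal w) : ENNReal.ofReal (a / w) ≤ X := by
  rw [ENNReal.ofReal_div_of_pos hw]
  exact ENNReal.div_le_of_le_mul h

theorem eLpNorm_extension_lift_dilate_slice {g : V → ℂ} (hg : Continuous g) {R : ℝ} (hR : 0 < R)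
    (t : ℝ) (q : ℝ≥0∞) :
    ENNReal.ofReal (R ^ d) * eLpNorm (𝓕 (modulate (massPhase R⁻¹) (R * t) g)) q volume =
      eLpNorm (fun x => extension d (lift fun ξ => g (R⁻¹ • ξ)) (t, x)) q volume *
        ENNReal.ofReal (((R / (2 * Real.pi)) ^ d) ^ (1 / q.toReal)) := by
  have hr : -(2 * Real.pi / R) ≠ 0 := neg_ne_zero.2 (by positivity)
  have h := eLpNorm_comp_smul (volume : Measure V)
    (fun x => extension d (lift fun ξ => g (R⁻¹ • ξ)) (t, x)) hr q
  simp only [extension_lift_dilate hg hR] at h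
  have e : (fun w => (R : ℂ) ^ d * 𝓕 (modulate (massPhase R⁻¹) (R * t) g) w) =
      (R ^ d : ℝ) • 𝓕 (modulate (massPhase R⁻¹) (R * t) g) := by
    ext w
    simp
  rw [e, eLpNorm_const_smul, Real.enorm_of_nonneg (by positivity)] at h
  rw [h, mul_comm, finrank_euclideanSpace_fin, abs_inv, abs_pow, abs_neg,
    abs_of_pos (by positivity), ← inv_pow, inv_div, ENNReal.ofReal_rpow_of_pos (by positivity)]

theorem le_eLpNorm_slice_of_le_fourier {g : V → ℂ} (hg : Continuous g) {R : ℝ} (hR : 0 < R)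
    {t N W δ : ℝ} (hW : 0 < W) {q : ℝ≥0∞}
    (h : ENNReal.ofReal N ≤ eLpNorm (𝓕 (modulate (massPhase R⁻¹) (R * t) g)) q volume *
      ENNReal.ofReal W ^ δ) :
    ENNReal.ofReal (N / W ^ δ / (((2 * Real.pi)⁻¹ ^ d) ^ (1 / q.toReal)) *
      R ^ (d - d * (1 / q.toReal))) ≤
      eLpNorm (fun x => extension d (lift fun ξ => g (R⁻¹ • ξ)) (t, x)) q volume := by
  rw [ENNReal.ofReal_rpow_of_pos hW] at h
  have h1 := mul_le_mul_right (ofReal_div_le_of_le_mul (by positivity) h) (ENNReal.ofReal (R ^ d))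
  rw [eLpNorm_extension_lift_dilate_slice hg hR, ← ENNReal.ofReal_mul (by positivity)] at h1
  refine le_trans (le_of_eq ?_) (ofReal_div_le_of_le_mul (by positivity) h1)
  congr 1
  rw [div_eq_inv_mul R, mul_pow, mul_pow_rpow_eq (by positivity) hR.le, Real.rpow_sub hR,
    Real.rpow_natCast]
  field_simp

/-- With `s = Rt` and `m = 1/R`, the requirements `s ≥ 1` and `s m² ≤ 1/4` become the two conditions
on `t`. The decay exponent involves `d - 1` because the wave fills only a shell of volume `s^{d-1}`.
-/
theorem exists_le_eLpNorm_slice_high [NeZero d] {g : V → ℂ} (hg : ContDiff ℝ ∞ g)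
    (hgc : HasCompactSupport g) (h0 : g ≠ 0) (hsupp : ∀ η, g η ≠ 0 → 1 ≤ ‖η‖) {q : ℝ≥0∞}
    (hq : 2 ≤ q) : ∃ c : ℝ, 0 < c ∧ ∀ R : ℝ, 0 < R → ∀ t : ℝ, 1 ≤ R * t → t ≤ R / 4 →
      ENNReal.ofReal (c * R ^ (d - d * (1 / q.toReal)) *
        (R * t) ^ (-((d - 1) * (1 / 2 - 1 / q.toReal)))) ≤
      eLpNorm (fun x => extension d (lift fun ξ => g (R⁻¹ • ξ)) (t, x)) q volume := by
  obtain ⟨N, W, hN, hW, h⟩ := exists_le_eLpNorm_fourier_modulate_massPhase hg hgc h0 hsupp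
  refine ⟨N / W ^ (1 / 2 - 1 / q.toReal) / (((2 * Real.pi)⁻¹ ^ d) ^ (1 / q.toReal)),
    by positivity, fun R hR t ht1 ht2 => ?_⟩
  have hs : 0 < R * t := by linarith
  refine le_trans (le_of_eq ?_) (le_eLpNorm_slice_of_le_fourier hg.continuous hR
    (by positivity) (h (R * t) ht1 R⁻¹ (by positivity) ?_ q hq))
  · rw [finrank_euclideanSpace_fin, mul_pow_rpow_eq hW.le hs.le, Real.rpow_neg hs.le,
      Nat.cast_sub NeZero.one_le, Nat.cast_one]
    congr 1
    field_simp
  · rw [inv_pow, ← div_eq_mul_inv, div_le_iff₀ (by positivity)]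
    nlinarith

/-- The case `R = 1` with no bound on `t`: past the cone regime only confinement to a ball of volume
of order `t^d` is used. -/
theorem exists_le_eLpNorm_slice_unit {g : V → ℂ} (hg : ContDiff ℝ ∞ g)
    (hgc : HasCompactSupport g) (h0 : g ≠ 0) {q : ℝ≥0∞}
    (hq : 2 ≤ q) : ∃ c : ℝ, 0 < c ∧ ∀ t : ℝ, 1 ≤ t →
      ENNReal.ofReal (c * t ^ (-(d * (1 / 2 - 1 / q.toReal)))) ≤
      eLpNorm (fun x => extension d (lift g) (t, x)) q volume := by
  obtain ⟨N, W, hN, hW, h⟩ :=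
    exists_le_eLpNorm_fourier_modulate (contDiff_massPhase one_ne_zero) hg hgc h0
  refine ⟨N / W ^ (1 / 2 - 1 / q.toReal) / (((2 * Real.pi)⁻¹ ^ d) ^ (1 / q.toReal)),
    by positivity, fun t ht => ?_⟩
  have ht0 : 0 < t := by linarith
  have := le_eLpNorm_slice_of_le_fourier hg.continuous one_pos (t := t) (N := N)
    (W := W * t ^ Module.finrank ℝ V) (δ := 1 / 2 - 1 / q.toReal) (q := q) (by positivity)
    (by rw [inv_one, one_mul]; exact h t ht q hq)
  simp only [inv_one, one_smul, Real.one_rpow, mul_one] at this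
  refine le_trans (le_of_eq ?_) this
  rw [finrank_euclideanSpace_fin, mul_pow_rpow_eq hW.le ht0.le, Real.rpow_neg ht0.le]
  congr 1
  field_simp

theorem lintegral_ofReal_mul_inv {a b K : ℝ} (ha : 0 < a) (hab : a ≤ b) (hK : 0 ≤ K) :
    ∫⁻ t in Set.Ioc a b, ENNReal.ofReal (K * t⁻¹) = ENNReal.ofReal (K * Real.log (b / a)) := by
  have hpos : ∀ t ∈ Set.uIcc a b, t ≠ 0 := fun t ht => by
    rw [Set.uIcc_of_le hab] at ht
    exact (ha.trans_le ht.1).ne'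
  rw [← integral_inv_of_pos ha (ha.trans_le hab), ← intervalIntegral.integral_const_mul,
    intervalIntegral.integral_of_le hab, ofReal_integral_eq_lintegral_ofReal]
  · exact (intervalIntegrable_iff_integrableOn_Ioc_of_le hab).1
      ((intervalIntegral.intervalIntegrable_inv hpos continuousOn_id).const_mul K)
  · refine (ae_restrict_iff' measurableSet_Ioc).2 (Filter.Eventually.of_forall fun t ht => ?_)
    have : 0 < t := ha.trans ht.1
    positivity

/-- `|F|^r ≤ B^{r-q} |F|^q`. Excluding the endpoint exponent thereby excludes all smaller ones. -/
theorem eLpNorm_ne_top_of_bounded {α : Type*} [MeasurableSpace α] {μ : Measure α} {F : α → ℂ}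
    {B : ℝ≥0} (hB : ∀ x, ‖F x‖ ≤ B) {q r : ℝ≥0∞} (hq : q ≠ 0) (hqr : q ≤ r) (hr : r ≠ ⊤)
    (hF : eLpNorm F q μ ≠ ⊤) : eLpNorm F r μ ≠ ⊤ := by
  have hr0 : r ≠ 0 := fun h => hq (le_antisymm (h ▸ hqr) bot_le)
  have hqT : q ≠ ⊤ := fun h => hr (top_le_iff.1 (h ▸ hqr))
  have hle : q.toReal ≤ r.toReal := ENNReal.toReal_mono hr hqr
  rw [← lt_top_iff_ne_top] at hF ⊢
  rw [eLpNorm_lt_top_iff_lintegral_rpow_enorm_lt_top hq hqT] at hF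
  rw [eLpNorm_lt_top_iff_lintegral_rpow_enorm_lt_top hr0 hr]
  refine lt_of_le_of_lt (lintegral_mono (g := fun x => (B : ℝ≥0∞) ^ (r.toReal - q.toReal) *
    ‖F x‖ₑ ^ q.toReal) fun x => ?_) ?_
  · have hBx : ‖F x‖ₑ ≤ B := by
      rw [← ofReal_norm, ← ENNReal.ofReal_coe_nnreal]
      exact ENNReal.ofReal_le_ofReal (hB x)
    calc ‖F x‖ₑ ^ r.toReal = ‖F x‖ₑ ^ (r.toReal - q.toReal) * ‖F x‖ₑ ^ q.toReal := by
          rw [← ENNReal.rpow_add_of_nonneg _ _ (sub_nonneg.2 hle) ENNReal.toReal_nonneg,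
            sub_add_cancel]
      _ ≤ _ := mul_le_mul_left (ENNReal.rpow_le_rpow hBx (sub_nonneg.2 hle)) _
  · have hfin : (B : ℝ≥0∞) ^ (r.toReal - q.toReal) ≠ ⊤ :=
      ENNReal.rpow_ne_top_of_nonneg (sub_nonneg.2 hle) ENNReal.coe_ne_top
    rw [lintegral_const_mul' _ _ hfin]
    exact ENNReal.mul_lt_top hfin.lt_top hF

theorem norm_extension_lift_le {g : V → ℂ} (hg : Continuous g) (z : ℝ × V) :
    ‖extension d (lift g) z‖ ≤ ∫ ξ, ‖g ξ‖ := by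
  rw [extension_lift hg]
  refine (norm_integral_le_integral_norm _).trans (le_of_eq ?_)
  refine integral_congr_ae (Filter.Eventually.of_forall fun ξ => ?_)
  simp only [norm_mul]
  rw [mul_comm Complex.I, Complex.norm_exp_ofReal_mul_I, one_mul]

theorem exists_complex_frequency_bump (hd : 1 ≤ d) : ∃ g : V → ℂ, ContDiff ℝ ∞ g ∧
    HasCompactSupport g ∧ g ≠ 0 ∧ (∀ η, ‖g η‖ ≤ 1) ∧ (∀ η, g η ≠ 0 → 1 ≤ ‖η‖ ∧ ‖η‖ ≤ 3) := by
  obtain ⟨ψ, hψs, hψc, hψ0, hψ1, hsupp, hI⟩ := exists_frequency_bump hd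
  refine ⟨fun η => (ψ η : ℂ), Complex.ofRealCLM.contDiff.comp hψs,
    hψc.comp_left (g := fun x : ℝ => (x : ℂ)) Complex.ofReal_zero, fun h => ?_, fun η => ?_,
    fun η h => hsupp η fun h' => h (by simp [h'])⟩
  · have : ∀ η, ψ η = 0 := fun η => by simpa using congrFun h η
    simp [this] at hI
  · rw [Complex.norm_real, Real.norm_of_nonneg (hψ0 η)]
    exact hψ1 η

/-- Dispersion at unit frequency excludes `q ≤ 2(d+1)/d`. -/
theorem necessary_dispersion (hd : 1 ≤ d) {p q : ℝ≥0∞} (hq : q ≠ 0) {C : ℝ≥0}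
    (hC : ∀ f : upperSheet d → ℂ, Continuous f → HasCompactSupport f →
      AEStronglyMeasurable (extension d f) volume ∧
        eLpNorm (extension d f) q volume ≤ C * eLpNorm f p (lorentzMeasure d)) :
    2 * ((d : ℝ≥0∞) + 1) / d < q := by
  by_contra! hle
  have : NeZero d := ⟨by omega⟩
  have hd0 : (0 : ℝ) < d := by exact_mod_cast hd
  have hd0' : (d : ℝ≥0∞) ≠ 0 := by exact_mod_cast (by omega : d ≠ 0)
  set r : ℝ≥0∞ := 2 * ((d : ℝ≥0∞) + 1) / d with hr
  have hrT : r ≠ ⊤ := by finiteness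
  have hr2 : 2 ≤ r := by
    rw [hr, ENNReal.le_div_iff_mul_le (Or.inl hd0') (Or.inl (by finiteness))]
    gcongr
    exact le_self_add
  have hrr : r.toReal = 2 * (d + 1) / d := by
    rw [hr, ENNReal.toReal_div, ENNReal.toReal_mul, ENNReal.toReal_add (by finiteness) (by finiteness)]
    simp
  have hr0 : 0 < r.toReal := by rw [hrr]; positivity
  obtain ⟨g, hgs, hgc, hg0, -, -⟩ := exists_complex_frequency_bump hd
  obtain ⟨hm, hb⟩ := hC _ (continuous_lift hgs.continuous) (hasCompactSupport_lift hgc)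
  have hfin : eLpNorm (extension d (lift g)) q volume ≠ ⊤ := by
    refine ne_top_of_le_ne_top (ENNReal.mul_ne_top ENNReal.coe_ne_top ?_) hb
    exact ((continuous_lift hgs.continuous).memLp_of_hasCompactSupport
      (hasCompactSupport_lift hgc)).eLpNorm_ne_top
  have hfin' := eLpNorm_ne_top_of_bounded (B := (∫ ξ, ‖g ξ‖).toNNReal) (fun z =>
    (norm_extension_lift_le hgs.continuous z).trans (Real.le_coe_toNNReal _)) hq hle hrT hfin
  obtain ⟨c, hc, hslice⟩ := exists_le_eLpNorm_slice_unit hgs hgc hg0 hr2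
  -- At the endpoint, `r · d(1/2 - 1/r) = 1`, so the slice bound to the power `r` is a multiple of
  -- `1/t`.
  have hlog : ∀ T : ℝ, 1 ≤ T → ENNReal.ofReal (c ^ r.toReal * Real.log T) ≤
      eLpNorm (extension d (lift g)) r volume ^ r.toReal := fun T hT => by
    refine le_trans (le_of_eq ?_) (lintegral_rpow_le_eLpNorm_rpow hm
      (zero_lt_two.trans_le hr2).ne' hrT (J := Set.Ioc 1 T) measurableSet_Ioc
      fun t ht => hslice t ht.1.le)
    have := lintegral_ofReal_mul_inv one_pos hT (by positivity : 0 ≤ c ^ r.toReal)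
    rw [div_one] at this
    rw [← this]
    refine setLIntegral_congr_fun measurableSet_Ioc fun t ht => ?_
    have ht0 : 0 < t := one_pos.trans ht.1
    rw [ENNReal.ofReal_rpow_of_pos (by positivity), Real.mul_rpow hc.le (by positivity),
      ← Real.rpow_mul ht0.le]
    congr 2
    rw [← Real.rpow_neg_one]
    congr 1
    rw [hrr]
    field_simp
    ring
  have hX : eLpNorm (extension d (lift g)) r volume ^ r.toReal ≠ ⊤ :=
    ENNReal.rpow_ne_top_of_nonneg hr0.le hfin'
  obtain ⟨T, hT1, hT2⟩ := ((Filter.eventually_ge_atTop 1).and ((Real.tendsto_log_atTop.const_mul_atTop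
    (by positivity : 0 < c ^ r.toReal)).eventually_gt_atTop
    (eLpNorm (extension d (lift g)) r volume ^ r.toReal).toReal)).exists
  exact absurd ((ENNReal.ofReal_le_iff_le_toReal hX).1 (hlog T hT1)) (not_le.2 hT2)

/-- Spreading of a wave of high frequency forces `p ≤ q`. -/
theorem necessary_spreading (hd : 1 ≤ d) {p q : ℝ≥0∞} (hq : 2 ≤ q) (hqT : q ≠ ⊤) {C : ℝ≥0}
    (hC : ∀ f : upperSheet d → ℂ, Continuous f → HasCompactSupport f →
      AEStronglyMeasurable (extension d f) volume ∧
        eLpNorm (extension d f) q volume ≤ C * eLpNorm f p (lorentzMeasure d)) :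
    (d - 1) * (1 / q.toReal) ≤ (d - 1) * (1 / p.toReal) := by
  have : NeZero d := ⟨by omega⟩
  have hd1 : (1 : ℝ) ≤ d := by exact_mod_cast hd
  have hq0 : q ≠ 0 := (zero_lt_two.trans_le hq).ne'
  have hqr := ENNReal.toReal_pos hq0 hqT
  obtain ⟨g, hgs, hgc, hg0, hg1, hsupp⟩ := exists_complex_frequency_bump hd
  have hgcont := hgs.continuous
  obtain ⟨c, hc, hslice⟩ := exists_le_eLpNorm_slice_high hgs hgc hg0 (fun η h => (hsupp η h).1) hq
  obtain ⟨c', hc', hup⟩ := exists_eLpNorm_lift_dilate_le hd hgcont hg1 hsupp p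
  set γ := (d - 1) * (1 / 2 - 1 / q.toReal) with hγ
  have hγ0 : 0 ≤ γ := mul_nonneg (by linarith) (half_sub_one_div_toReal_nonneg hq)
  have key : ∀ᶠ R : ℝ in Filter.atTop, (c * (1 / 8) ^ (1 / q.toReal)) *
      R ^ (d - d * (1 / q.toReal) + -(2 * γ) + 1 / q.toReal) ≤
        (C * c') * R ^ (1 + (d - 1) * (1 / p.toReal)) := by
    filter_upwards [Filter.eventually_ge_atTop 4] with R hR
    have hR0 : 0 < R := by linarith
    have hcpt : HasCompactSupport fun ξ : V => g (R⁻¹ • ξ) := hgc.comp_smul (inv_ne_zero hR0.ne')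
    have hcont : Continuous fun ξ : V => g (R⁻¹ • ξ) := by fun_prop
    have hm := (hC _ (continuous_lift hcont) (hasCompactSupport_lift hcpt)).1
    -- The last times of the cone regime; there `Rt ≤ R²`, so the decay factor is at least
    -- `R^{-2γ}`.
    have h1 := lintegral_rpow_le_eLpNorm_rpow hm hq0 hqT (J := Set.Ioc (R / 8) (R / 4))
      measurableSet_Ioc (k := fun _ => ENNReal.ofReal (c * R ^ (d - d * (1 / q.toReal)) *
        (R ^ 2) ^ (-γ))) fun t ht => by
      refine le_trans (ENNReal.ofReal_le_ofReal ?_) (hslice R hR0 t (by nlinarith [ht.1]) ht.2)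
      refine mul_le_mul_of_nonneg_left (Real.rpow_le_rpow_of_nonpos ?_ ?_ (by linarith))
        (by positivity)
      · nlinarith [ht.1]
      · nlinarith [ht.2]
    rw [setLIntegral_const, Real.volume_Ioc, ← ENNReal.rpow_le_rpow_iff (z := 1 / q.toReal)
      (by positivity), ENNReal.mul_rpow_of_nonneg _ _ (by positivity), ← ENNReal.rpow_mul,
      ← ENNReal.rpow_mul, mul_one_div_cancel hqr.ne', ENNReal.rpow_one, ENNReal.rpow_one,
      show R / 4 - R / 8 = 1 / 8 * R by ring, ENNReal.ofReal_rpow_of_pos (by positivity),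
      ← ENNReal.ofReal_mul (by positivity)] at h1
    have := le_of_ofReal_le_of_bound hC hcont hcpt (by positivity) h1 (hup R (by linarith))
    refine le_trans (le_of_eq ?_) (this.trans (le_of_eq (by ring)))
    rw [Real.rpow_add hR0, Real.rpow_add hR0, Real.mul_rpow (by norm_num) hR0.le,
      ← Real.rpow_natCast R 2, ← Real.rpow_mul hR0.le]
    push_cast
    rw [mul_neg]
    ring
  -- The exponent on the left equals `1 + (d-1)/q`.
  have := le_of_forall_rpow_le (by positivity) key
  rw [hγ] at this
  linarith

/-- Logarithmic divergence at the endpoint of the cone. -/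
theorem necessary_cone_endpoint (hd : 2 ≤ d) {p q : ℝ≥0∞} (hp : p = q) (hqT : q ≠ ⊤) {C : ℝ≥0}
    (hqd : (d - 1) * q.toReal = 2 * d)
    (hC : ∀ f : upperSheet d → ℂ, Continuous f → HasCompactSupport f →
      AEStronglyMeasurable (extension d f) volume ∧
        eLpNorm (extension d f) q volume ≤ C * eLpNorm f p (lorentzMeasure d)) : False := by
  subst hp
  have : NeZero d := ⟨by omega⟩
  have hd1 : (2 : ℝ) ≤ d := by exact_mod_cast hd
  have hp2 : 2 ≤ p.toReal := by nlinarith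
  have hpr : 0 < p.toReal := by linarith
  have hp : 2 ≤ p := by
    rw [← ENNReal.ofReal_toReal hqT, ← ENNReal.ofReal_ofNat 2]
    exact ENNReal.ofReal_le_ofReal hp2
  have hp0 : p ≠ 0 := (zero_lt_two.trans_le hp).ne'
  obtain ⟨g, hgs, hgc, hg0, hg1, hsupp⟩ := exists_complex_frequency_bump (d := d) (by omega)
  have hgcont := hgs.continuous
  obtain ⟨c, hc, hslice⟩ := exists_le_eLpNorm_slice_high hgs hgc hg0 (fun η h => (hsupp η h).1) hp
  obtain ⟨c', hc', hup⟩ := exists_eLpNorm_lift_dilate_le (by omega) hgcont hg1 hsupp p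
  have key : ∀ᶠ R : ℝ in Filter.atTop,
      c ^ p.toReal * Real.log (1 / 4 * R ^ 2) ≤ (C * c') ^ p.toReal := by
    filter_upwards [Filter.eventually_ge_atTop 2] with R hR
    have hR0 : 0 < R := by linarith
    have hcpt : HasCompactSupport fun ξ : V => g (R⁻¹ • ξ) := hgc.comp_smul (inv_ne_zero hR0.ne')
    have hcont : Continuous fun ξ : V => g (R⁻¹ • ξ) := by fun_prop
    have hm := (hC _ (continuous_lift hcont) (hasCompactSupport_lift hcpt)).1
    have hab : R⁻¹ ≤ R / 4 := by rw [inv_le_iff_one_le_mul₀ hR0]; nlinarith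
    have hlog0 : 0 ≤ Real.log (R / 4 / R⁻¹) :=
      Real.log_nonneg (by rw [one_le_div (by positivity)]; exact hab)
    have h1 := lintegral_rpow_le_eLpNorm_rpow hm hp0 hqT (J := Set.Ioc R⁻¹ (R / 4))
      measurableSet_Ioc fun t ht => hslice R hR0 t (by
        have := mul_le_mul_of_nonneg_left ht.1.le hR0.le
        rwa [mul_inv_cancel₀ hR0.ne'] at this) ht.2
    -- When `(d-1)p = 2d` the decay exponent times `p` is `1`, so every dyadic block of the window
    -- contributes equally.
    have e : ∫⁻ t in Set.Ioc R⁻¹ (R / 4), ENNReal.ofReal (c * R ^ (d - d * (1 / p.toReal)) *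
        (R * t) ^ (-((d - 1) * (1 / 2 - 1 / p.toReal)))) ^ p.toReal =
        ENNReal.ofReal (c ^ p.toReal * R ^ (d * p.toReal - d - 1) * Real.log (R / 4 / R⁻¹)) := by
      rw [← lintegral_ofReal_mul_inv (by positivity) hab (by positivity)]
      refine setLIntegral_congr_fun measurableSet_Ioc fun t ht => ?_
      have ht0 : 0 < t := (inv_pos.2 hR0).trans ht.1
      rw [ENNReal.ofReal_rpow_of_pos (by positivity), Real.mul_rpow (by positivity) (by positivity),
        Real.mul_rpow hc.le (by positivity), ← Real.rpow_mul hR0.le,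
        ← Real.rpow_mul (by positivity : 0 ≤ R * t),
        show -((d - 1) * (1 / 2 - 1 / p.toReal)) * p.toReal = -1 by
          field_simp; linear_combination (-1 : ℝ) * hqd,
        Real.rpow_neg_one, mul_inv, Real.rpow_sub_one hR0.ne',
        show (d - d * (1 / p.toReal)) * p.toReal = d * p.toReal - d by field_simp]
      congr 1
      ring
    rw [e] at h1
    have h2 : eLpNorm (extension d (lift fun ξ => g (R⁻¹ • ξ))) p volume ^ p.toReal ≤
        ENNReal.ofReal ((C * (c' * R ^ (1 + (d - 1) * (1 / p.toReal)))) ^ p.toReal) := by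
      rw [← ENNReal.ofReal_rpow_of_nonneg (by positivity) hpr.le,
        ENNReal.ofReal_mul C.coe_nonneg, ENNReal.ofReal_coe_nnreal]
      refine ENNReal.rpow_le_rpow ?_ hpr.le
      exact (hC _ (continuous_lift hcont) (hasCompactSupport_lift hcpt)).2.trans
        (mul_le_mul_right (hup R (by linarith)) _)
    have h3 := (ENNReal.ofReal_le_ofReal_iff (by positivity)).1 (h1.trans h2)
    -- The same relation makes the powers of `R` on both sides agree, leaving only the logarithm.
    rw [← mul_assoc (C : ℝ), Real.mul_rpow (by positivity) (by positivity), ← Real.rpow_mul hR0.le,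
      show (1 + (d - 1) * (1 / p.toReal)) * p.toReal = d * p.toReal - d - 1 by
        field_simp; linear_combination (-1 : ℝ) * hqd,
      show R / 4 / R⁻¹ = 1 / 4 * R ^ 2 by field_simp] at h3
    have hRp : 0 < R ^ (d * p.toReal - d - 1) := by positivity
    refine le_of_mul_le_mul_right ?_ hRp
    linarith
  have ht : Filter.Tendsto (fun R : ℝ => c ^ p.toReal * Real.log (1 / 4 * R ^ 2)) Filter.atTop
      Filter.atTop :=
    (Real.tendsto_log_atTop.comp ((Filter.tendsto_pow_atTop two_ne_zero).const_mul_atTop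
      (by norm_num))).const_mul_atTop (by positivity)
  obtain ⟨R, h1, h2⟩ := (key.and (ht.eventually_gt_atTop _)).exists
  exact absurd h1 (not_le.2 h2)

/-! ### Conjugate exponents and conclusion -/

/-- For `r ≤ 1` truncated subtraction makes both sides `0`, matching `r' = ∞`. The bounds on `p`
become linear in `1/p` and `1/q`. -/
theorem inv_conjExponent (r : ℝ≥0∞) : (ENNReal.conjExponent r)⁻¹ = 1 - r⁻¹ := by
  rcases le_total r 1 with h | h
  · rw [ENNReal.conjExponent, tsub_eq_zero_of_le h, tsub_eq_zero_of_le (ENNReal.one_le_inv.2 h)]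
    simp
  · have := (ENNReal.HolderConjugate.conjExponent h).inv_add_inv_eq_one
    rw [← this, ENNReal.add_sub_cancel_left]
    exact ENNReal.inv_ne_top.2 (zero_lt_one.trans_le h).ne'

end Hyperboloid

end

theorem mainTheorem3 (d : ℕ) (hd : 2 ≤ d) (p q : ℝ≥0∞) [Fact (1 ≤ p)] [Fact (1 ≤ q)]
    (h : Hyperboloid.ExtensionEstimate d p q) :
    ENNReal.conjExponent ((d : ℝ≥0∞) / (d + 2) * q) ≤ p ∧
      p ≤ min (ENNReal.conjExponent (((d : ℝ≥0∞) - 1) / (d + 1) * q)) q ∧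
      (p, q) ≠ (2 * (d : ℝ≥0∞) / (d - 1), 2 * (d : ℝ≥0∞) / (d - 1)) ∧
      (p, q) ≠ (2 * ((d : ℝ≥0∞) + 1) / d, 2 * ((d : ℝ≥0∞) + 1) / d) := by
  obtain ⟨C, hC⟩ := Hyperboloid.exists_bound_of_extensionEstimate h
  have hp1 : 1 ≤ p := Fact.out
  have hq1 : 1 ≤ q := Fact.out
  have hp0 : p ≠ 0 := (zero_lt_one.trans_le hp1).ne'
  have hq0 : q ≠ 0 := (zero_lt_one.trans_le hq1).ne'
  have hd1 : 1 ≤ d := by omega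
  have hdR : (2 : ℝ) ≤ d := by exact_mod_cast hd
  have hdE : (d : ℝ≥0∞) ≠ 0 := by exact_mod_cast (by omega : d ≠ 0)
  have hdm : ((d : ℝ≥0∞) - 1) ≠ 0 := by
    rw [Ne, tsub_eq_zero_iff_le, not_le]
    exact_mod_cast (by omega : 1 < d)
  have hdmr : ((d : ℝ≥0∞) - 1).toReal = d - 1 := by
    rw [ENNReal.toReal_sub_of_le (by exact_mod_cast hd1) (by finiteness)]
    simp
  have hpiT : p⁻¹ ≠ ⊤ := ENNReal.inv_ne_top.2 hp0
  have hqiT : q⁻¹ ≠ ⊤ := ENNReal.inv_ne_top.2 hq0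
  have hlow := Hyperboloid.necessary_low_frequency hq0 hC
  have hhigh := Hyperboloid.necessary_high_frequency hd1 hq0 hC
  have hdisp := Hyperboloid.necessary_dispersion hd1 hq0 hC
  -- Dispersion also supplies `q ≥ 2`, which the Hölder step in the spreading example requires.
  have hq2 : 2 ≤ q := by
    refine le_trans ?_ hdisp.le
    rw [ENNReal.le_div_iff_mul_le (Or.inl hdE) (Or.inl (by finiteness))]
    gcongr
    exact le_self_add
  simp only [one_div, ← ENNReal.toReal_inv] at hlow hhigh
  have inv_mul : ∀ x y : ℝ≥0∞, x ≠ 0 → x ≠ ⊤ → y ≠ 0 → y ≠ ⊤ → (x / y * q)⁻¹ = y / x * q⁻¹ := by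
    intro x y hx hx' hy hy'
    rw [ENNReal.mul_inv (Or.inl (ENNReal.div_ne_zero.2 ⟨hx, hy'⟩))
      (Or.inl (ENNReal.div_ne_top hx' hy)), ENNReal.inv_div (Or.inl hy') (Or.inl hy)]
  refine ⟨?_, le_min ?_ ?_, ?_, ?_⟩
  · rw [← ENNReal.inv_le_inv, Hyperboloid.inv_conjExponent,
      inv_mul _ _ hdE (by finiteness) (by simp) (by finiteness)]
    have hfin : ((d : ℝ≥0∞) + 2) / d * q⁻¹ ≠ ⊤ := by finiteness
    -- The subtraction being truncated, the untruncated inequality `1/p + (d+2)/(dq) ≤ 1` is proved;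
    -- the Knapp example gives exactly this.
    refine ENNReal.le_sub_of_add_le_right hfin ?_
    rw [← ENNReal.toReal_le_toReal (by finiteness) (by finiteness),
      ENNReal.toReal_add hpiT hfin, ENNReal.toReal_mul, ENNReal.toReal_div,
      ENNReal.toReal_add (by finiteness) (by finiteness)]
    simp only [ENNReal.toReal_natCast, ENNReal.toReal_ofNat, ENNReal.toReal_one]
    rw [← le_sub_iff_add_le, div_mul_eq_mul_div, le_sub_iff_add_le, ← le_sub_iff_add_le',
      div_le_iff₀ (by positivity)]
    linarith
  · rw [← ENNReal.inv_le_inv, Hyperboloid.inv_conjExponent,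
      inv_mul _ _ hdm (by finiteness) (by simp) (by finiteness), tsub_le_iff_right]
    have hfin : ((d : ℝ≥0∞) + 1) / (d - 1) * q⁻¹ ≠ ⊤ :=
      ENNReal.mul_ne_top (ENNReal.div_ne_top (by finiteness) hdm) hqiT
    rw [← ENNReal.toReal_le_toReal (by finiteness) (by finiteness),
      ENNReal.toReal_add hpiT hfin, ENNReal.toReal_mul, ENNReal.toReal_div,
      ENNReal.toReal_add (by finiteness) (by finiteness), hdmr]
    simp only [ENNReal.toReal_natCast, ENNReal.toReal_one]
    rw [← sub_le_iff_le_add', div_mul_eq_mul_div, le_div_iff₀ (by linarith)]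
    linarith
  · rcases eq_or_ne q ⊤ with rfl | hqT
    · exact le_top
    · have := Hyperboloid.necessary_spreading hd1 hq2 hqT hC
      simp only [one_div, ← ENNReal.toReal_inv] at this
      rw [← ENNReal.inv_le_inv, ← ENNReal.toReal_le_toReal hqiT hpiT]
      exact le_of_mul_le_mul_left this (by linarith)
  · rintro heq
    obtain ⟨hp, hq⟩ := Prod.mk.inj heq
    refine Hyperboloid.necessary_cone_endpoint hd (hp.trans hq.symm) ?_ ?_ hC
    · rw [hq]
      exact ENNReal.div_ne_top (by finiteness) hdm
    · rw [hq, ENNReal.toReal_div, hdmr, ENNReal.toReal_mul]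
      simp only [ENNReal.toReal_natCast, ENNReal.toReal_ofNat]
      rw [mul_div_cancel₀]
      linarith
  · rintro heq
    obtain ⟨hp, hq⟩ := Prod.mk.inj heq
    -- The strict dispersion bound excludes every `p` at this `q`.
    exact hdisp.ne' hq
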